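/- A \emph{Kummer structure} is a set $K$ with a map $\kappa$ from the set of unordered pairs of elements of $K$ to itself such that, writing $a\ b\to c\ d$ for $\kappa\{a,b\}=\{c,d\}$: (A1) there is $0\in K$ with $a\ 0\to a\ a$ for all $a$; (A2) for every $a$ there is $2a\in K$ with $a\ a\to 0\ 2a$; (A3) for all $a,b,c$ there are $p_0,p_1,q_0,q_1,s_0,\dots,s_3\in K$ with $a\ b\to p_0\ p_1$, $c\ b\to q_0\ q_1$, $a\ q_0\to s_0\ s_1$, $a\ q_1\to s_2\ s_3$, $c\ p_0\to s_0\ s_2$, $c\ p_1\to s_1\ s_3$; (A4) $a\ b\to c\ d$ implies $2a\ 2b\to 2c\ 2d$. The \emph{Kummer} of an abelian group $G$ is the set of all $\bar x=\{x,-x\}$, $x\in G$, with $\kappa\{\bar x,\bar y\}=\{\overline{x+y},\overline{x-y}\}$. The \emph{twisted Kummer} of $(G,\iota)$, where $G$ is an abelian group with $2G=0$ and $\iota$ is an automorphism of $G$ with $\iota^2=1$, is the set of all $\bar x=\{x,\iota x\}$, $x\in G$, with $\kappa\{\bar x,\bar y\}=\{\overline{x+y},\overline{x+\iota y}\}$.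 Let $K$ be a Kummer structure that is 4-torsion ($2(2a)=0$ for all $a\in K$) but not 2-torsion ($2a\neq0$ for some $a\in K$). Let $K[2]=\{a\in K\mid 2a=0\}$. For $a\in K$ and $x\in K[2]$ there is a unique element $a+x\in K$ with $a\ x\to (a+x)\ (a+x)$; this makes $K[2]$ a vector space over $\mathbb{Z}/2$ which acts on $K$, and the image $2K$ of the map $a\mapsto 2a$ is a subspace of $K[2]$. Rank means dimension over $\mathbb{Z}/2$. Given a choice of representatives $e_x\in K$ $(x\in 2K)$ with $2e_x=x$ and $e_0=0$, for $x,y\in 2K$ let $\epsilon_{x,y}\in K[2]/\langle x,y\rangle$ be the class consisting of the $u\in K[2]$ with $e_{x+y}+u\in\kappa\{e_x,e_y\}$. For a rank-3 subgroup $X\subseteq 2K$ put $\mathrm{ind}_X=0$ if the representatives can be chosen such that $\epsilon_{x,y}=0$ for all $x,y\in X$ that generate a rank-2 subgroup, and $\mathrm{ind}_X=1$ otherwise. Then: (0) $\mathrm{ind}_X$ is the same for all rank-3 subgroups $X\subseteq 2K$; if $\mathrm{rank}\,2K\ge3$, let $\mathrm{ind}_K$ denote this common value. (1) $K$ is isomorphic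 to the Kummer of an abelian group if and only if $\mathrm{rank}\,2K\le2$ or $\mathrm{ind}_K=1$. (2) $K$ is isomorphic to the twisted Kummer of some $(G,\iota)$ if and only if $\mathrm{rank}\,2K\le2$ or $\mathrm{ind}_K=0$. -/

import Mathlib

universe u

/-- A Kummer structure on a set `K`: a map `κ` on unordered pairs of elements of `K` satisfying
four axioms. The element `zero` and the map `dbl` (written `0` and `a ↦ 2a` in mathematical
notation) are uniquely determined by `κ`. -/
class KummerStructure (K : Type u) where
  /-- the structure map on unordered pairs -/
  κ : Sym2 K → Sym2 K
  /-- the element `0` -/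
  zero : K
  /-- the map `a ↦ 2a` -/
  dbl : K → K
  κ_zero : ∀ a, κ s(a, zero) = s(a, a)
  κ_self : ∀ a, κ s(a, a) = s(zero, dbl a)
  κ_assoc : ∀ a b c, ∃ p₀ p₁ q₀ q₁ s₀ s₁ s₂ s₃,
    κ s(a, b) = s(p₀, p₁) ∧ κ s(c, b) = s(q₀, q₁) ∧
    κ s(a, q₀) = s(s₀, s₁) ∧ κ s(a, q₁) = s(s₂, s₃) ∧
    κ s(c, p₀) = s(s₀, s₂) ∧ κ s(c, p₁) = s(s₁, s₃)
  κ_dbl : ∀ a b c d, κ s(a, b) = s(c, d) → κ s(dbl a, dbl b) = s(dbl c, dbl d)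

namespace KummerStructure

/-- An isomorphism of Kummer structures: a bijection commuting with the structure maps. -/
structure Iso (K : Type u) (L : Type u) [KummerStructure K] [KummerStructure L] extends
    K ≃ L where
  map_κ : ∀ p : Sym2 K, Sym2.map toFun (κ p) = κ (Sym2.map toFun p)

/-! ### Quotients of abelian groups by an involution -/

section Quotients

variable {G : Type u} [AddCommGroup G]

/-- `x` and `y` are identified iff they lie in the same set `{x, ι x}`. -/
def orbitSetoid (ι : G ≃+ G) (hι : ∀ x, ι (ι x) = x) : Setoid G where
  r x y := y = x ∨ y = ι x
  iseqv :=
    { refl := fun _ => Or.inl rfl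
      symm := by
        rintro x y (rfl | rfl)
        · exact Or.inl rfl
        · exact Or.inr (hι x).symm
      trans := by
        rintro x y z (rfl | rfl) (rfl | rfl)
        · exact Or.inl rfl
        · exact Or.inr rfl
        · exact Or.inr rfl
        · exact Or.inl (hι x) }

/-- The set of all `{x, ι x}`. -/
def InvQuot (ι : G ≃+ G) (hι : ∀ x, ι (ι x) = x) : Type u := Quotient (orbitSetoid ι hι)

namespace InvQuot

variable (ι : G ≃+ G) (hι : ∀ x, ι (ι x) = x)

/-- The class `{x, ι x}` of `x`. -/
def mk (x : G) : InvQuot ι hι := Quotient.mk (orbitSetoid ι hι) x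

variable {ι hι}

theorem mk_eq_iff {x y : G} : mk ι hι x = mk ι hι y ↔ y = x ∨ y = ι x :=
  Quotient.eq (r := orbitSetoid ι hι)

theorem mk_ι (x : G) : mk ι hι (ι x) = mk ι hι x :=
  mk_eq_iff.2 (Or.inr (hι x).symm)

theorem mk_ι_add (x y : G) : mk ι hι (ι x + y) = mk ι hι (x + ι y) := by
  rw [← mk_ι (hι := hι) (ι x + y), map_add, hι]

variable (ι hι)

/-- `{x, ι x}, {y, ι y} ↦ {x + y, ι (x + y)}, {x + ι y, ι (x + ι y)}`. -/
def kap : Sym2 (InvQuot ι hι) → Sym2 (InvQuot ι hι) :=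
  Sym2.lift ⟨fun p q => Quotient.liftOn₂ p q
      (fun x y => s(mk ι hι (x + y), mk ι hι (x + ι y)))
      (by
        rintro x y x' y' (rfl | rfl) (rfl | rfl)
        · rfl
        · rw [hι, Sym2.eq_swap]
        · rw [mk_ι_add, ← map_add, mk_ι, Sym2.eq_swap]
        · rw [← map_add, mk_ι, mk_ι_add, hι]),
    by
      rintro ⟨x⟩ ⟨y⟩
      change s(mk ι hι (x + y), mk ι hι (x + ι y)) = s(mk ι hι (y + x), mk ι hι (y + ι x))
      rw [add_comm y x, add_comm y (ι x), mk_ι_add]⟩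

theorem kap_mk (x y : G) :
    kap ι hι s(mk ι hι x, mk ι hι y) = s(mk ι hι (x + y), mk ι hι (x + ι y)) := rfl

theorem kap_assoc (a b c : InvQuot ι hι) : ∃ p₀ p₁ q₀ q₁ s₀ s₁ s₂ s₃,
    kap ι hι s(a, b) = s(p₀, p₁) ∧ kap ι hι s(c, b) = s(q₀, q₁) ∧
    kap ι hι s(a, q₀) = s(s₀, s₁) ∧ kap ι hι s(a, q₁) = s(s₂, s₃) ∧
    kap ι hι s(c, p₀) = s(s₀, s₂) ∧ kap ι hι s(c, p₁) = s(s₁, s₃) := by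
  obtain ⟨a⟩ := a
  obtain ⟨b⟩ := b
  obtain ⟨c⟩ := c
  refine ⟨mk ι hι (a + b), mk ι hι (a + ι b), mk ι hι (c + b), mk ι hι (c + ι b),
    mk ι hι (a + (c + b)), mk ι hι (a + ι (c + b)), mk ι hι (a + ι (c + ι b)),
    mk ι hι (a + (c + ι b)), kap_mk .., kap_mk .., kap_mk .., ?_, ?_, ?_⟩
  · exact (kap_mk ..).trans Sym2.eq_swap
  · refine (kap_mk ..).trans ?_
    refine congrArg₂ (fun u v => s(u, v)) ?_ ?_
    · abel_nf
    · rw [← mk_ι (hι := hι) (c + ι (a + b))]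
      simp only [map_add, hι]
      abel_nf
  · refine (kap_mk ..).trans (Sym2.eq_swap.trans ?_)
    refine congrArg₂ (fun u v => s(u, v)) ?_ ?_
    · rw [← mk_ι (hι := hι) (c + ι (a + ι b))]
      simp only [map_add, hι]
      abel_nf
    · abel_nf

/-- The map `{x, ι x} ↦ {f x, ι (f x)}` induced by an endomorphism `f` commuting with `ι`. -/
def map (f : G →+ G) (hf : ∀ x, f (ι x) = ι (f x)) : InvQuot ι hι → InvQuot ι hι :=
  Quotient.lift (fun x => mk ι hι (f x)) (by
    rintro x y (rfl | rfl)
    · rfl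
    · rw [hf, mk_ι])

theorem kap_map (f : G →+ G) (hf : ∀ x, f (ι x) = ι (f x)) (a b c d : InvQuot ι hι)
    (h : kap ι hι s(a, b) = s(c, d)) :
    kap ι hι s(map ι hι f hf a, map ι hι f hf b) = s(map ι hι f hf c, map ι hι f hf d) := by
  obtain ⟨x⟩ := a
  obtain ⟨y⟩ := b
  refine Eq.trans ?_ (congrArg (Sym2.map (map ι hι f hf)) h)
  change s(mk ι hι (f x + f y), mk ι hι (f x + ι (f y))) =
    s(mk ι hι (f (x + y)), mk ι hι (f (x + ι y)))
  rw [map_add, map_add, hf]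

end InvQuot

variable (G) in
/-- The set `{ {x, -x} | x ∈ G }` underlying the Kummer of the abelian group `G`. -/
def Kummer : Type u := InvQuot (AddEquiv.neg G) (fun x => neg_neg x)

/-- The Kummer of the abelian group `G`, with structure map
`{±x}, {±y} ↦ {±(x + y)}, {±(x - y)}`, zero `{0}` and `2 {±x} = {±2x}`. -/
instance instKummer : KummerStructure (Kummer G) where
  κ := InvQuot.kap _ _
  zero := InvQuot.mk _ _ 0
  dbl := InvQuot.map _ _ (AddMonoidHom.id G + AddMonoidHom.id G)
    (fun x => (map_add (AddEquiv.neg G) x x).symm)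
  κ_zero := by
    rintro ⟨x⟩
    refine (InvQuot.kap_mk ..).trans ?_
    rw [map_zero, add_zero]
    rfl
  κ_self := by
    rintro ⟨x⟩
    refine (InvQuot.kap_mk ..).trans (Sym2.eq_swap.trans ?_)
    rw [AddEquiv.neg_apply, add_neg_cancel]
    rfl
  κ_assoc := InvQuot.kap_assoc _ _
  κ_dbl := InvQuot.kap_map _ _ _ _

variable (G) in
/-- A twisted group: a 2-torsion abelian group together with an involution `ι`
(an automorphism with `ι² = 1`). -/
structure TwistedGroup where
  two_torsion : ∀ x : G, x + x = 0
  ι : G ≃+ G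
  ι_ι : ∀ x, ι (ι x) = x

/-- The set `{ {x, ι x} | x ∈ G }` underlying the twisted Kummer of `(G, ι)`. -/
def TwistedKummer (T : TwistedGroup G) : Type u := InvQuot T.ι T.ι_ι

/-- The twisted Kummer of `(G, ι)`, with structure map
`{x, ι x}, {y, ι y} ↦ {x + y, ι (x + y)}, {x + ι y, ι (x + ι y)}`, zero `{0}` and
`2 {x, ι x} = {x + ι x}`. -/
instance instTwistedKummer (T : TwistedGroup G) : KummerStructure (TwistedKummer T) where
  κ := InvQuot.kap _ _
  zero := InvQuot.mk _ _ 0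
  dbl := InvQuot.map _ _ (AddMonoidHom.id G + T.ι.toAddMonoidHom)
    (fun x => (map_add T.ι x (T.ι x)).symm)
  κ_zero := by
    rintro ⟨x⟩
    refine (InvQuot.kap_mk ..).trans ?_
    rw [map_zero, add_zero]
    rfl
  κ_self := by
    rintro ⟨x⟩
    refine (InvQuot.kap_mk ..).trans ?_
    rw [T.two_torsion]
    rfl
  κ_assoc := InvQuot.kap_assoc _ _
  κ_dbl := InvQuot.kap_map _ _ _ _

end Quotients

/-! ### First properties -/

section Basic

variable {K : Type u} [KummerStructure K]

theorem dbl_zero : dbl (zero : K) = zero := by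
  have h := (κ_self (zero : K)).symm.trans (κ_zero zero)
  rw [Sym2.eq_iff] at h
  tauto

theorem mem_κ_rot {a b c : K} (h : c ∈ κ s(a, b)) : a ∈ κ s(b, c) := by
  obtain ⟨p₀, p₁, q₀, q₁, s₀, s₁, s₂, s₃, h1, h2, h3, h4, h5, h6⟩ := κ_assoc a b b
  have hz := κ_zero a
  have hs := κ_self b
  rw [h1, Sym2.mem_iff] at h
  rw [h2, Sym2.eq_iff] at hs
  rcases hs with ⟨rfl, -⟩ | ⟨-, rfl⟩
  · rw [h3, Sym2.eq_iff] at hz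
    rcases h with rfl | rfl
    · rw [h5, Sym2.mem_iff]; tauto
    · rw [h6, Sym2.mem_iff]; tauto
  · rw [h4, Sym2.eq_iff] at hz
    rcases h with rfl | rfl
    · rw [h5, Sym2.mem_iff]; tauto
    · rw [h6, Sym2.mem_iff]; tauto

theorem mem_κ_iff {a b c : K} : c ∈ κ s(a, b) ↔ a ∈ κ s(b, c) :=
  ⟨mem_κ_rot, fun h => mem_κ_rot (mem_κ_rot h)⟩

theorem mem_κ_comm {a b c : K} : c ∈ κ s(a, b) ↔ b ∈ κ s(a, c) := by
  rw [mem_κ_iff, mem_κ_iff, Sym2.eq_swap]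

theorem zero_mem_κ {a b : K} : zero ∈ κ s(a, b) ↔ a = b := by
  rw [mem_κ_iff, κ_zero, Sym2.mem_iff, or_self]

/-- The associativity diagram with a prescribed ordering of two of the pairs. -/
theorem κ_assoc' {a b c p₀ p₁ q₀ q₁ : K} (hp : κ s(a, b) = s(p₀, p₁))
    (hq : κ s(c, b) = s(q₀, q₁)) : ∃ s₀ s₁ s₂ s₃,
    κ s(a, q₀) = s(s₀, s₁) ∧ κ s(a, q₁) = s(s₂, s₃) ∧
    κ s(c, p₀) = s(s₀, s₂) ∧ κ s(c, p₁) = s(s₁, s₃) := by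
  obtain ⟨p₀', p₁', q₀', q₁', s₀, s₁, s₂, s₃, h1, h2, h3, h4, h5, h6⟩ := κ_assoc a b c
  rw [hp, Sym2.eq_iff] at h1
  rw [hq, Sym2.eq_iff] at h2
  rcases h1 with ⟨rfl, rfl⟩ | ⟨rfl, rfl⟩ <;> rcases h2 with ⟨rfl, rfl⟩ | ⟨rfl, rfl⟩
  · exact ⟨s₀, s₁, s₂, s₃, h3, h4, h5, h6⟩
  · exact ⟨s₂, s₃, s₀, s₁, h4, h3, h5.trans Sym2.eq_swap, h6.trans Sym2.eq_swap⟩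
  · exact ⟨s₁, s₀, s₃, s₂, h3.trans Sym2.eq_swap, h4.trans Sym2.eq_swap, h6, h5⟩
  · exact ⟨s₃, s₂, s₁, s₀, h4.trans Sym2.eq_swap, h3.trans Sym2.eq_swap,
      h6.trans Sym2.eq_swap, h5.trans Sym2.eq_swap⟩

theorem dbl_mem_κ {a b c d : K} (h : κ s(a, b) = s(c, d)) : dbl a ∈ κ s(c, d) := by
  have ha : a ∈ κ s(c, b) := by
    rw [Sym2.eq_swap]
    exact mem_κ_rot (by rw [h]; exact Sym2.mem_mk_left _ _)
  obtain ⟨e, he⟩ := ha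
  obtain ⟨s₀, s₁, s₂, s₃, h3, -, h5, h6⟩ := κ_assoc' h he
  rw [κ_self, Sym2.eq_iff] at h3
  rcases h3 with ⟨-, rfl⟩ | ⟨rfl, rfl⟩
  · rw [h6]; exact Sym2.mem_mk_left _ _
  · have hcd : c = d := zero_mem_κ.1 (by rw [h6]; exact Sym2.mem_mk_left _ _)
    subst hcd
    rw [h5]; exact Sym2.mem_mk_left _ _

theorem κ_κ_aux {a b c d : K} (h : κ s(a, b) = s(c, d)) (hab : dbl a = dbl b)
    (hc : dbl c = zero) : κ s(c, d) = s(dbl a, dbl b) := by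
  have ha : a ∈ κ s(c, b) := by
    rw [Sym2.eq_swap]
    exact mem_κ_rot (by rw [h]; exact Sym2.mem_mk_left _ _)
  obtain ⟨e, he⟩ := ha
  obtain ⟨s₀, s₁, s₂, s₃, h3, h4, h5, h6⟩ := κ_assoc' h he
  have h00 : s₀ = zero ∧ s₂ = zero := by
    rw [κ_self, hc, Sym2.eq_iff] at h5
    tauto
  obtain ⟨rfl, rfl⟩ := h00
  have hae : a = e := zero_mem_κ.1 (by rw [h4]; exact Sym2.mem_mk_left _ _)
  subst hae
  rw [κ_self, Sym2.congr_right] at h3 h4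
  rw [h6, ← h3, ← h4, hab]

theorem κ_κ {a b c d : K} (h : κ s(a, b) = s(c, d)) : κ s(c, d) = s(dbl a, dbl b) := by
  by_cases hab : dbl a = dbl b
  · have h2 := κ_dbl _ _ _ _ h
    have hz : zero ∈ s(dbl c, dbl d) := by rw [← h2, zero_mem_κ]; exact hab
    rcases Sym2.mem_iff.1 hz with hz | hz
    · exact κ_κ_aux h hab hz.symm
    · rw [Sym2.eq_swap]
      exact κ_κ_aux (h.trans Sym2.eq_swap) hab hz.symm
  · exact (Sym2.mem_and_mem_iff hab).1
      ⟨dbl_mem_κ h, dbl_mem_κ ((congrArg κ Sym2.eq_swap).trans h)⟩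

theorem eq_iff_of_κ {a b c d : K} (h : κ s(a, b) = s(c, d)) :
    c = d ↔ dbl a = zero ∨ dbl b = zero := by
  rw [← zero_mem_κ, κ_κ h, Sym2.mem_iff, eq_comm, @eq_comm _ zero (dbl b)]

end Basic

/-! ### The 2-torsion and its action -/

section Torsion

variable (K : Type u) [KummerStructure K]

/-- The 2-torsion `K[2] = {a ∈ K | 2a = 0}`. -/
def TwoTorsion : Type u := {a : K // dbl a = zero}

variable {K}

theorem exists_act (a : K) (x : TwoTorsion K) : ∃ b, κ s(a, x.1) = s(b, b) := by
  obtain ⟨c, d, h⟩ : ∃ c d, κ s(a, x.1) = s(c, d) := by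
    induction κ s(a, x.1) with | _ c d => exact ⟨c, d, rfl⟩
  obtain rfl := (eq_iff_of_κ h).2 (Or.inr x.2)
  exact ⟨c, h⟩

/-- For `a ∈ K` and `x ∈ K[2]`, the element `a + x` of `K` with `κ {a, x} = {a + x, a + x}`. -/
noncomputable def act (a : K) (x : TwoTorsion K) : K := (exists_act a x).choose

theorem κ_act (a : K) (x : TwoTorsion K) : κ s(a, x.1) = s(act a x, act a x) :=
  (exists_act a x).choose_spec

theorem eq_act_iff {a b : K} {x : TwoTorsion K} : b = act a x ↔ b ∈ κ s(a, x.1) := by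
  rw [κ_act, Sym2.mem_iff, or_self]

theorem eq_act_of_κ {a b c : K} {x : TwoTorsion K} (h : κ s(a, x.1) = s(b, c)) :
    b = act a x := by
  rw [eq_act_iff, h]; exact Sym2.mem_mk_left _ _

theorem dbl_act (a : K) (x : TwoTorsion K) : dbl (act a x) = dbl a := by
  have h := κ_dbl _ _ _ _ (κ_act a x)
  rw [x.2, κ_zero, Sym2.eq_iff] at h
  tauto

/-- The group law on `K[2]`: `κ {x, y} = {x + y, x + y}`. -/
noncomputable instance : Add (TwoTorsion K) :=
  ⟨fun x y => ⟨act x.1 y, (dbl_act x.1 y).trans x.2⟩⟩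

instance : Zero (TwoTorsion K) := ⟨⟨zero, dbl_zero⟩⟩

theorem κ_add (x y : TwoTorsion K) : κ s(x.1, y.1) = s((x + y).1, (x + y).1) := κ_act x.1 y

theorem act_add (a : K) (x y : TwoTorsion K) : act a (x + y) = act (act a x) y := by
  have hq : κ s(y.1, x.1) = s((x + y).1, (x + y).1) := by rw [Sym2.eq_swap, κ_add]
  obtain ⟨s₀, s₁, s₂, s₃, h3, h4, h5, h6⟩ := κ_assoc' (κ_act a x) hq
  rw [Sym2.eq_swap] at h5
  exact (eq_act_of_κ h3).symm.trans (eq_act_of_κ h5)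

theorem act_zero (a : K) : act a (0 : TwoTorsion K) = a :=
  (eq_act_of_κ (κ_zero a)).symm

theorem two_torsion_add_comm (x y : TwoTorsion K) : x + y = y + x :=
  Subtype.ext (eq_act_of_κ (by rw [Sym2.eq_swap, κ_add]))

theorem two_torsion_add_self (x : TwoTorsion K) : x + x = 0 := by
  refine Subtype.ext (Eq.symm (eq_act_of_κ (c := dbl x.1) ?_))
  exact κ_self x.1

instance : Neg (TwoTorsion K) := ⟨fun x => x⟩

/-- `K[2]` is an abelian group. -/
noncomputable instance : AddCommGroup (TwoTorsion K) where
  add_assoc x y z := (Subtype.ext (act_add x.1 y z)).symm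
  zero_add x := (two_torsion_add_comm 0 x).trans (Subtype.ext (act_zero x.1))
  add_zero x := Subtype.ext (act_zero x.1)
  nsmul := nsmulRec
  zsmul := zsmulRec
  neg_add_cancel := two_torsion_add_self
  add_comm := two_torsion_add_comm

/-- `K[2]` is 2-torsion, hence a vector space over `ℤ/2`. -/
noncomputable instance : Module (ZMod 2) (TwoTorsion K) :=
  AddCommGroup.zmodModule (fun x => (two_nsmul x).trans (two_torsion_add_self x))

theorem dbl_eq_add {a b c : K} {x y : TwoTorsion K} (ha : dbl a = x.1) (hb : dbl b = y.1)
    (hc : c ∈ κ s(a, b)) : dbl c = (x + y).1 := by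
  obtain ⟨d, hd⟩ := hc
  have h := κ_dbl _ _ _ _ hd
  rw [ha, hb, κ_add, Sym2.eq_iff] at h
  rcases h with h | h
  · exact h.1.symm
  · exact h.2.symm

theorem exists_mem_κ (a b : K) : ∃ c, c ∈ κ s(a, b) := by
  induction κ s(a, b) with | _ c d => exact ⟨c, Sym2.mem_mk_left _ _⟩

variable (K) in
/-- The subgroup of those elements of `K[2]` that lie in the image `2K` of the map `2`.
When `K` is 4-torsion, `2K ⊆ K[2]`, so this subgroup is all of `2K`. -/
noncomputable def twoK : Submodule (ZMod 2) (TwoTorsion K) :=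
  AddSubgroup.toZModSubmodule 2
    { carrier := {x | ∃ a : K, dbl a = x.1}
      zero_mem' := ⟨zero, dbl_zero⟩
      add_mem' := by
        rintro x y ⟨a, ha⟩ ⟨b, hb⟩
        obtain ⟨c, hc⟩ := exists_mem_κ a b
        exact ⟨c, dbl_eq_add ha hb hc⟩
      neg_mem' := fun h => h }

/-- If `2a = 2b ∈ K[2]` then `b = a + x` for some `x ∈ K[2]`. -/
theorem exists_eq_act {a b : K} (hab : dbl a = dbl b) (ha : dbl (dbl a) = zero) :
    ∃ x : TwoTorsion K, b = act a x := by
  obtain ⟨c, d, h⟩ : ∃ c d, κ s(a, b) = s(c, d) := by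
    induction κ s(a, b) with | _ c d => exact ⟨c, d, rfl⟩
  have h2 := κ_dbl _ _ _ _ h
  rw [← hab, κ_self, ha, Sym2.eq_iff] at h2
  have hc : dbl c = zero := by
    rcases h2 with h2 | h2
    · exact h2.1.symm
    · exact h2.2.symm
  refine ⟨⟨c, hc⟩, eq_act_iff.2 (mem_κ_comm.1 ?_)⟩
  rw [h]; exact Sym2.mem_mk_left _ _

end Torsion

/-! ### The pairing `ε` and the index -/

section Index

variable (K : Type u) [KummerStructure K]

/-- A choice of representatives `e x ∈ K` with `2 (e x) = x` for all `x ∈ 2K`, and `e 0 = 0`. -/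
structure Reps where
  e : twoK K → K
  dbl_e : ∀ x, dbl (e x) = x.1.1
  e_zero : e 0 = zero

variable {K}

theorem Reps.exists_eps (r : Reps K) (x y : twoK K) :
    ∃ u : TwoTorsion K, act (r.e (x + y)) u ∈ κ s(r.e x, r.e y) := by
  obtain ⟨c, hc⟩ := exists_mem_κ (r.e x) (r.e y)
  have h : dbl (r.e (x + y)) = dbl c :=
    (r.dbl_e (x + y)).trans (dbl_eq_add (r.dbl_e x) (r.dbl_e y) hc).symm
  obtain ⟨u, rfl⟩ := exists_eq_act h (by rw [r.dbl_e]; exact (x + y).1.2)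
  exact ⟨u, hc⟩

/-- The value `ε_{x,y} ∈ K[2] / ⟨x, y⟩` of the pairing attached to a choice of representatives:
the class of those `u ∈ K[2]` with `e x + e y = ± (e (x + y) + u)`, that is, with
`e (x + y) + u` a member of the pair `κ {e x, e y}`. -/
noncomputable def Reps.eps (r : Reps K) (x y : twoK K) :
    TwoTorsion K ⧸ Submodule.span (ZMod 2) {x.1, y.1} :=
  Submodule.Quotient.mk (r.exists_eps x y).choose

theorem mem_span_pair_two {x y w : TwoTorsion K} :
    w ∈ Submodule.span (ZMod 2) {x, y} ↔ (w = 0 ∨ w = x + y) ∨ (w = x ∨ w = y) := by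
  rw [Submodule.mem_span_pair]
  constructor
  · rintro ⟨a, b, rfl⟩
    have key : ∀ a : ZMod 2, a = 0 ∨ a = 1 := by decide
    rcases key a with rfl | rfl <;> rcases key b with rfl | rfl <;> simp
  · rintro ((rfl | rfl) | (rfl | rfl))
    · exact ⟨0, 0, by simp⟩
    · exact ⟨1, 1, by simp⟩
    · exact ⟨1, 0, by simp⟩
    · exact ⟨0, 1, by simp⟩

theorem act_mem_κ_iff {a b c : K} {x y : TwoTorsion K} (ha : dbl a = x.1) (hb : dbl b = y.1)
    (hc : c ∈ κ s(a, b)) (w : TwoTorsion K) :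
    act c w ∈ κ s(a, b) ↔ w ∈ Submodule.span (ZMod 2) {x, y} := by
  have hdc := dbl_eq_add ha hb hc
  obtain ⟨d, hd⟩ := hc
  have hcd := κ_κ hd
  rw [mem_span_pair_two, hd, Sym2.mem_iff]
  refine or_congr ?_ ?_
  · rw [eq_comm, eq_act_iff, mem_κ_comm, κ_self, hdc, Sym2.mem_iff]
    exact or_congr (Subtype.ext_iff (a2 := (0 : TwoTorsion K))).symm Subtype.ext_iff.symm
  · rw [eq_comm, eq_act_iff, mem_κ_comm, hcd, ha, hb, Sym2.mem_iff]
    exact or_congr Subtype.ext_iff.symm Subtype.ext_iff.symm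

/-- `ε_{x,y}` is well defined: it is exactly the set of all admissible `u`. -/
theorem Reps.eps_eq_mk_iff (r : Reps K) (x y : twoK K) (u : TwoTorsion K) :
    r.eps x y = Submodule.Quotient.mk u ↔ act (r.e (x + y)) u ∈ κ s(r.e x, r.e y) := by
  have h := act_mem_κ_iff (r.dbl_e x) (r.dbl_e y) (r.exists_eps x y).choose_spec
    (-(r.exists_eps x y).choose + u)
  rw [← act_add, add_neg_cancel_left] at h
  rw [h, eps, eq_comm, Submodule.Quotient.eq, sub_eq_neg_add]

open Classical in
/-- The index of a (rank-3) subgroup `X ⊆ 2K`: it is `0` if representatives can be chosen such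
that `ε_V = 0` for all rank-2 subgroups `V = ⟨x, y⟩ ⊆ X`, and `1` otherwise. -/
noncomputable def indSub (X : Submodule (ZMod 2) (twoK K)) : ℕ :=
  if ∃ r : Reps K, ∀ x ∈ X, ∀ y ∈ X,
      Module.finrank (ZMod 2) (Submodule.span (ZMod 2) {x, y}) = 2 → r.eps x y = 0
  then 0 else 1

variable (K) in
open Classical in
/-- The index of `K`: the index of any rank-3 subgroup of `2K` (only meaningful if one
exists, that is, if `rank 2K ≥ 3`). -/
noncomputable def ind : ℕ :=
  if h : ∃ X : Submodule (ZMod 2) (twoK K), Module.finrank (ZMod 2) X = 3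
  then indSub h.choose else 0

end Index

end KummerStructure

/-!
Lifted to `K[2]`, the pairing `ε` of a 4-torsion Kummer structure satisfies the symmetry and
cocycle relations of a 2-cocycle on `2K`, but only modulo `⟨x, y⟩`; changing the representatives
adds a coboundary. On a subgroup `U` on which `ε` is trivial one can normalise `ε` at a further
element `b`, and then all that is left on `b + U` is a function `θ x y ∈ ℤ/2` with
`θ x y + θ y z + θ x z = 0` in general position. If `U` has rank 2, the only obstruction to writing
`θ x y = t x + t y` is the sum of `θ` over the three pairs of nonzero elements, which is additive in
`ε`. If `U` has rank at least 3, there is none. Hence, by Zorn's lemma, `ε` is trivial on all of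
`2K` as soon as it is trivial on one subgroup of rank 3, and of two pairings that are not trivial
on it, the sum is trivial.

A trivial `ε` presents `K` as a twisted Kummer of the split extension of `2K` by `K[2]`, and every
twisted Kummer arises so. Likewise `K` is a Kummer if and only if `ε` lifts to a 2-cocycle `S` with
`S x x = x`, the cocycle of the extension `G` of `2K` by `K[2]`. Such an `S` always exists, and it
is nontrivial on every subgroup of rank 3, so any other nontrivial `ε` differs from it by a trivial
one.
-/

namespace KummerStructure

section Pairings

variable {V : Type*} [AddCommGroup V] [Module (ZMod 2) V] {W : Submodule (ZMod 2) V}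

theorem zmod_two_eq_zero_or_one : ∀ a : ZMod 2, a = 0 ∨ a = 1 := by
  decide

theorem add_add_cancel_left_of_zmod_two {M : Type*} [AddCommGroup M] [Module (ZMod 2) M]
    (x y : M) : x + (x + y) = y := by
  rw [← add_assoc, ZModModule.add_self, zero_add]

theorem smodEq_iff_add_mem {P : Submodule (ZMod 2) V} {v w : V} :
    v ≡ w [SMOD P] ↔ v + w ∈ P := by
  rw [SModEq.sub_mem, ZModModule.sub_eq_add]

/-- The subgroup `⟨x, y⟩`, with respect to which pairings at `(x, y)` are considered. -/
abbrev plane (x y : W) : Submodule (ZMod 2) V :=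
  Submodule.span (ZMod 2) {x.1, y.1}

theorem left_mem_plane (x y : W) : x.1 ∈ plane x y :=
  Submodule.subset_span (Set.mem_insert _ _)

theorem right_mem_plane (x y : W) : y.1 ∈ plane x y :=
  Submodule.subset_span (Set.mem_insert_of_mem _ rfl)

theorem plane_le_iff {x y : W} {P : Submodule (ZMod 2) V} :
    plane x y ≤ P ↔ x.1 ∈ P ∧ y.1 ∈ P := by
  simp [Submodule.span_le, Set.pair_subset_iff]

theorem plane_comm (x y : W) : plane x y = plane y x := by
  rw [plane, Set.pair_comm]

theorem plane_add_right (x y : W) : plane x (x + y) = plane x y := by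
  refine le_antisymm (plane_le_iff.2 ⟨left_mem_plane x y, ?_⟩)
    (plane_le_iff.2 ⟨left_mem_plane x (x + y), ?_⟩)
  · exact add_mem (left_mem_plane x y) (right_mem_plane x y)
  · have h := sub_mem (right_mem_plane x (x + y)) (left_mem_plane x (x + y))
    simpa using h

/-- The relations satisfied by the pairing `ε` of a 4-torsion Kummer structure, for a lift of its
values from `K[2] / ⟨x, y⟩` to `K[2]`. -/
structure IsKummerCocycle (ε : W → W → V) : Prop where
  zero (x) : ε x 0 ∈ plane x 0
  swap (x y) : ε x y ≡ ε y x [SMOD plane x y]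
  rot (x y) : ε x (x + y) ≡ ε x y [SMOD plane x y]
  assoc (x y z) : ε x y + ε (x + y) z ≡ ε x (y + z) + ε y z
    [SMOD Submodule.span (ZMod 2) {x.1, y.1, z.1}]

theorem isKummerCocycle_zero : IsKummerCocycle (0 : W → W → V) where
  zero _ := zero_mem _
  swap _ _ := rfl
  rot _ _ := rfl
  assoc _ _ _ := rfl

/-- The coboundary of `u`: the change of `ε` when the representatives `e_x` are replaced by
`e_x + u x`. -/
def coboundary (u : W → V) (x y : W) : V := u x + u y + u (x + y)

theorem coboundary_add (u u' : W → V) :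
    coboundary (u + u') = coboundary u + coboundary u' := by
  ext x y
  simp only [coboundary, Pi.add_apply]
  abel

theorem coboundary_assoc (u : W → V) (x y z : W) :
    coboundary u x y + coboundary u (x + y) z = coboundary u x (y + z) + coboundary u y z := by
  simp only [coboundary, ← add_assoc]
  grind [ZModModule.add_self (u (x + y)), ZModModule.add_self (u (y + z))]

theorem IsKummerCocycle.add {ε ε' : W → W → V} (h : IsKummerCocycle ε)
    (h' : IsKummerCocycle ε') : IsKummerCocycle (ε + ε') where
  zero x := add_mem (h.zero x) (h'.zero x)
  swap x y := (h.swap x y).add (h'.swap x y)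
  rot x y := (h.rot x y).add (h'.rot x y)
  assoc x y z := by
    have key := (h.assoc x y z).add (h'.assoc x y z)
    rwa [add_add_add_comm, add_add_add_comm (ε x (y + z))] at key

theorem isKummerCocycle_coboundary {u : W → V} (hu : u 0 = 0) :
    IsKummerCocycle (coboundary u) where
  zero x := by simp [coboundary, hu, ZModModule.add_self]
  swap x y := by simp only [coboundary, add_comm]; rfl
  rot x y := by
    rw [coboundary, coboundary, add_add_cancel_left_of_zmod_two, add_right_comm]
  assoc x y z := by
    rw [coboundary_assoc]

theorem IsKummerCocycle.add_coboundary {ε : W → W → V} (h : IsKummerCocycle ε) {u : W → V}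
    (hu : u 0 = 0) : IsKummerCocycle (ε + coboundary u) :=
  h.add (isKummerCocycle_coboundary hu)

/-- `ε` vanishes at `(x, y)` modulo `⟨x, y⟩`. -/
def IsTrivialAt (ε : W → W → V) (x y : W) : Prop := ε x y ∈ plane x y

section IsTrivialAt

variable {ε ε' : W → W → V} {x y : W}

theorem IsTrivialAt.add (h : IsTrivialAt ε x y) (h' : IsTrivialAt ε' x y) :
    IsTrivialAt (ε + ε') x y :=
  add_mem h h'

theorem isTrivialAt_coboundary {u : W → V} (hx : u x ∈ plane x y) (hy : u y ∈ plane x y)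
    (hxy : u (x + y) ∈ plane x y) : IsTrivialAt (coboundary u) x y :=
  add_mem (add_mem hx hy) hxy

namespace IsKummerCocycle

theorem isTrivialAt_comm (h : IsKummerCocycle ε) : IsTrivialAt ε x y ↔ IsTrivialAt ε y x := by
  rw [IsTrivialAt, IsTrivialAt, plane_comm y x, ← SModEq.zero, ← SModEq.zero]
  exact ⟨(h.swap x y).symm.trans, (h.swap x y).trans⟩

theorem isTrivialAt_add_right (h : IsKummerCocycle ε) :
    IsTrivialAt ε x (x + y) ↔ IsTrivialAt ε x y := by
  rw [IsTrivialAt, IsTrivialAt, plane_add_right, ← SModEq.zero, ← SModEq.zero]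
  exact ⟨(h.rot x y).symm.trans, (h.rot x y).trans⟩

theorem isTrivialAt_zero_right (h : IsKummerCocycle ε) (x : W) : IsTrivialAt ε x 0 :=
  h.zero x

theorem isTrivialAt_zero_left (h : IsKummerCocycle ε) (x : W) : IsTrivialAt ε 0 x :=
  h.isTrivialAt_comm.2 (h.isTrivialAt_zero_right x)

theorem isTrivialAt_self (h : IsKummerCocycle ε) (x : W) : IsTrivialAt ε x x := by
  rw [← h.isTrivialAt_add_right, ZModModule.add_self]
  exact h.isTrivialAt_zero_right x

end IsKummerCocycle

end IsTrivialAt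

/-- `ε` is trivial on the subgroup `U`. -/
def IsTrivialOn (U : Submodule (ZMod 2) W) (ε : W → W → V) : Prop :=
  ∀ x ∈ U, ∀ y ∈ U, IsTrivialAt ε x y

/-- `ε` becomes trivial on `U` after a change of representatives. -/
def IsTrivializableOn (U : Submodule (ZMod 2) W) (ε : W → W → V) : Prop :=
  ∃ u : W → V, u 0 = 0 ∧ IsTrivialOn U (ε + coboundary u)

section Trivializable

variable {U : Submodule (ZMod 2) W} {ε ε' : W → W → V} {b : W}

theorem IsTrivialOn.add (h : IsTrivialOn U ε) (h' : IsTrivialOn U ε') :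
    IsTrivialOn U (ε + ε') :=
  fun x hx y hy => (h x hx y hy).add (h' x hx y hy)

theorem isTrivialOn_coboundary {u : W → V} (hu : ∀ x ∈ U, u x = 0) :
    IsTrivialOn U (coboundary u) := fun x hx y hy => by
  rw [IsTrivialAt, coboundary, hu x hx, hu y hy, hu _ (add_mem hx hy), add_zero, add_zero]
  exact zero_mem _

theorem IsTrivialOn.isTrivializableOn (h : IsTrivialOn U ε) : IsTrivializableOn U ε :=
  ⟨0, rfl, h.add (isTrivialOn_coboundary fun _ _ => rfl)⟩

theorem IsTrivializableOn.of_add_coboundary {u : W → V} (hu : u 0 = 0)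
    (h : IsTrivializableOn U (ε + coboundary u)) : IsTrivializableOn U ε := by
  obtain ⟨u', hu', h⟩ := h
  refine ⟨u + u', by rw [Pi.add_apply, hu, hu', add_zero], ?_⟩
  rwa [coboundary_add, ← add_assoc]

theorem mem_span_singleton_sup_iff {x : W} :
    x ∈ Submodule.span (ZMod 2) {b} ⊔ U ↔ x ∈ U ∨ ∃ y ∈ U, b + y = x := by
  simp only [Submodule.mem_sup, Submodule.mem_span_singleton, exists_exists_eq_and]
  constructor
  · rintro ⟨a, y, hy, rfl⟩
    obtain rfl | rfl := zmod_two_eq_zero_or_one a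
    · exact .inl (by rwa [zero_smul, zero_add])
    · exact .inr ⟨y, hy, by rw [one_smul]⟩
  · rintro (hx | ⟨y, hy, rfl⟩)
    · exact ⟨0, x, hx, by rw [zero_smul, zero_add]⟩
    · exact ⟨1, y, hy, by rw [one_smul]⟩

theorem add_notMem (hb : b ∉ U) {x : W} (hx : x ∈ U) : b + x ∉ U :=
  fun h => hb ((U.add_mem_iff_left hx).1 h)

/-- `ε` is trivial on `U` and at all `(b, x)` with `x ∈ U`; the remaining obstruction to triviality
on `⟨b⟩ + U` lies in the values of `ε` on the coset `b + U`. -/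
structure IsNormalizedAt (U : Submodule (ZMod 2) W) (b : W) (ε : W → W → V) : Prop where
  isTrivialOn : IsTrivialOn U ε
  isTrivialAt_left : ∀ x ∈ U, IsTrivialAt ε b x

theorem IsNormalizedAt.add (h : IsNormalizedAt U b ε) (h' : IsNormalizedAt U b ε') :
    IsNormalizedAt U b (ε + ε') :=
  ⟨h.isTrivialOn.add h'.isTrivialOn,
    fun x hx => (h.isTrivialAt_left x hx).add (h'.isTrivialAt_left x hx)⟩

theorem IsNormalizedAt.isTrivialOn_span_singleton_sup (hn : IsNormalizedAt U b ε)
    (h : IsKummerCocycle ε)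
    (hcoset : ∀ x ∈ U, ∀ y ∈ U, x ≠ 0 → y ≠ 0 → x ≠ y → IsTrivialAt ε (b + x) (b + y)) :
    IsTrivialOn (Submodule.span (ZMod 2) {b} ⊔ U) ε := by
  have coset_coset : ∀ x ∈ U, ∀ y ∈ U, IsTrivialAt ε (b + x) (b + y) := fun x hx y hy => by
    rcases eq_or_ne x 0 with rfl | hx0
    · rw [add_zero, h.isTrivialAt_add_right]
      exact hn.isTrivialAt_left y hy
    rcases eq_or_ne y 0 with rfl | hy0
    · rw [add_zero, h.isTrivialAt_comm, h.isTrivialAt_add_right]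
      exact hn.isTrivialAt_left x hx
    rcases eq_or_ne x y with rfl | hxy
    · exact h.isTrivialAt_self _
    · exact hcoset x hx y hy hx0 hy0 hxy
  have coset_sub : ∀ x ∈ U, ∀ y ∈ U, IsTrivialAt ε (b + x) y := fun x hx y hy => by
    rw [← h.isTrivialAt_add_right, add_assoc]
    exact coset_coset x hx (x + y) (add_mem hx hy)
  intro x hx y hy
  rw [mem_span_singleton_sup_iff] at hx hy
  obtain hx | ⟨x, hx, rfl⟩ := hx <;> obtain hy | ⟨y, hy, rfl⟩ := hy
  · exact hn.isTrivialOn x hx y hy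
  · exact h.isTrivialAt_comm.2 (coset_sub y hy x hx)
  · exact coset_sub x hx y hy
  · exact coset_coset x hx y hy

theorem IsTrivialOn.exists_isNormalizedAt (hU : IsTrivialOn U ε) (h : IsKummerCocycle ε)
    (hb : b ∉ U) : ∃ u : W → V, (∀ x ∈ U, u x = 0) ∧ IsNormalizedAt U b (ε + coboundary u) := by
  classical
  let u : W → V := fun p => if p ∈ U then 0 else ε b (b + p)
  have hu : ∀ x ∈ U, u x = 0 := fun x hx => if_pos hx
  have hu' : ∀ x ∈ U, u (b + x) = ε b x := fun x hx => by
    simp only [u, if_neg (add_notMem hb hx), add_add_cancel_left_of_zmod_two]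
  refine ⟨u, hu, hU.add (isTrivialOn_coboundary hu), fun x hx => ?_⟩
  have hval : (ε + coboundary u) b x = ε b 0 := by
    rw [← hu' 0 (zero_mem U), add_zero, Pi.add_apply, Pi.add_apply, coboundary, hu x hx, hu' x hx,
      add_zero, add_left_comm, ZModModule.add_self, add_zero]
  rw [IsTrivialAt, hval]
  exact plane_le_iff.2 ⟨left_mem_plane b x, zero_mem _⟩ (h.zero b)

theorem IsTrivializableOn.span_singleton_sup (hU : IsTrivializableOn U ε)
    (h : IsKummerCocycle ε) (hcard : ∀ x ∈ U, ∀ y ∈ U, x ≠ 0 → y ≠ 0 → x = y) (b : W) :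
    IsTrivializableOn (Submodule.span (ZMod 2) {b} ⊔ U) ε := by
  by_cases hb : b ∈ U
  · rwa [sup_eq_right.2 ((Submodule.span_singleton_le_iff_mem b U).2 hb)]
  obtain ⟨u, hu, hU⟩ := hU
  refine .of_add_coboundary hu ?_
  obtain ⟨u', hu', hn⟩ := hU.exists_isNormalizedAt (h.add_coboundary hu) hb
  have hu'0 := hu' 0 (zero_mem U)
  exact ⟨u', hu'0, hn.isTrivialOn_span_singleton_sup ((h.add_coboundary hu).add_coboundary hu'0)
    fun x hx y hy hx0 hy0 hxy => absurd (hcard x hx y hy hx0 hy0) hxy⟩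

theorem IsKummerCocycle.isTrivializableOn_span_pair (h : IsKummerCocycle ε) (b c : W) :
    IsTrivializableOn (Submodule.span (ZMod 2) {b, c}) ε := by
  have hbot : IsTrivialOn ⊥ ε := by
    rintro _ rfl _ rfl
    exact h.isTrivialAt_self 0
  have hc : IsTrivializableOn (Submodule.span (ZMod 2) {c}) ε := by
    simpa using hbot.isTrivializableOn.span_singleton_sup h (by simp) c
  rw [Submodule.span_insert]
  refine hc.span_singleton_sup h (fun x hx y hy hx0 hy0 => ?_) b
  have key (z : W) (hz : z ∈ Submodule.span (ZMod 2) {c}) (hz0 : z ≠ 0) : z = c := by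
    obtain ⟨a, rfl⟩ := Submodule.mem_span_singleton.1 hz
    obtain rfl | rfl := zmod_two_eq_zero_or_one a
    · exact absurd (zero_smul _ c) hz0
    · exact one_smul _ c
  rw [key x hx hx0, key y hy hy0]

/-- `θ` measures the failure of `ε`, normalised at `b`, to vanish on the coset `b + U`. -/
def IsDefect (U : Submodule (ZMod 2) W) (b : W) (ε : W → W → V) (θ : W → W → ZMod 2) : Prop :=
  ∀ x ∈ U, ∀ y ∈ U, ε (b + x) (b + y) ≡ θ x y • b.1 [SMOD plane (b + x) (b + y)]

variable {θ θ' : W → W → ZMod 2} {x y z x₀ : W}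

theorem IsDefect.add (hθ : IsDefect U b ε θ) (hθ' : IsDefect U b ε' θ') :
    IsDefect U b (ε + ε') (θ + θ') := fun x hx y hy => by
  simp only [Pi.add_apply, add_smul]
  exact (hθ x hx y hy).add (hθ' x hx y hy)

theorem IsNormalizedAt.apply_mem_span (hn : IsNormalizedAt U b ε) (h : IsKummerCocycle ε)
    (hx : x ∈ U) (hy : y ∈ U) :
    ε (b + x) (b + y) ∈ Submodule.span (ZMod 2) {b.1, x.1, y.1} := by
  set P := Submodule.span (ZMod 2) {b.1, x.1, y.1}
  have hbP : b.1 ∈ P := Submodule.subset_span (by simp)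
  have hxP : x.1 ∈ P := Submodule.subset_span (by simp)
  have hyP : y.1 ∈ P := Submodule.subset_span (by simp)
  have hb : ∀ z ∈ U, z.1 ∈ P → ε b z ≡ 0 [SMOD P] := fun z hz hzP =>
    SModEq.zero.2 (plane_le_iff.2 ⟨hbP, hzP⟩ (hn.isTrivialAt_left z hz))
  have hU : ε x (x + y) ≡ 0 [SMOD P] :=
    SModEq.zero.2 (plane_le_iff.2 ⟨hxP, add_mem hxP hyP⟩ (hn.isTrivialOn x hx _ (add_mem hx hy)))
  have hrot : ε (b + x) (b + y) ≡ ε (b + x) (x + y) [SMOD P] := by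
    have key := h.rot (b + x) (x + y)
    rw [add_assoc b, add_add_cancel_left_of_zmod_two] at key
    exact key.mono (plane_le_iff.2 ⟨add_mem hbP hxP, add_mem hxP hyP⟩)
  have hassoc : ε b x + ε (b + x) (x + y) ≡ ε b y + ε x (x + y) [SMOD P] := by
    have key := h.assoc b x (x + y)
    rw [add_add_cancel_left_of_zmod_two] at key
    refine key.mono (Submodule.span_le.2 ?_)
    rintro _ (rfl | rfl | rfl)
    exacts [hbP, hxP, add_mem hxP hyP]
  have hzero := hassoc.trans ((hb y hy hyP).add hU)
  rw [add_zero, SModEq.zero, P.add_mem_iff_right (SModEq.zero.1 (hb x hx hxP))] at hzero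
  exact SModEq.zero.1 (hrot.trans (SModEq.zero.2 hzero))

theorem IsNormalizedAt.exists_isDefect (hn : IsNormalizedAt U b ε) (h : IsKummerCocycle ε) :
    ∃ θ, IsDefect U b ε θ := by
  have key (x y : W) (hx : x ∈ U) (hy : y ∈ U) :
      ∃ d : ZMod 2, ε (b + x) (b + y) ≡ d • b.1 [SMOD plane (b + x) (b + y)] := by
    obtain ⟨α, β, γ, hv⟩ := Submodule.mem_span_triple.1 (hn.apply_mem_span h hx hy)
    refine ⟨α + β + γ, SModEq.sub_mem.2 (Submodule.mem_span_pair.2 ⟨β, γ, ?_⟩)⟩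
    rw [← hv, Submodule.coe_add, Submodule.coe_add]
    linear_combination (norm := module) (β + γ) • ZModModule.add_self b.1
  choose! θ hθ using key
  exact ⟨θ, fun x hx y hy => hθ x y hx hy⟩

theorem eq_zero_of_smul_mem_span_coset (hb : b ∉ U) (hx : x ∈ U) (hy : y ∈ U) (hz : z ∈ U)
    (hx0 : x ≠ 0) (hy0 : y ≠ 0) (hz0 : z ≠ 0) (hxyz : x + y + z ≠ 0) {d : ZMod 2}
    (hd : d • b.1 ∈ Submodule.span (ZMod 2) {(b + x).1, (b + y).1, (b + z).1}) : d = 0 := by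
  obtain ⟨α, β, γ, h⟩ := Submodule.mem_span_triple.1 hd
  have h : α • (b + x) + β • (b + y) + γ • (b + z) = d • b := Subtype.ext h
  have hU : (α + β + γ + d) • b = α • x + β • y + γ • z := by
    linear_combination (norm := module) h + d • ZModModule.add_self b -
      α • ZModModule.add_self x - β • ZModModule.add_self y - γ • ZModModule.add_self z
  have hsum : α + β + γ + d = 0 := by
    by_contra hne
    rw [(zmod_two_eq_zero_or_one _).resolve_left hne, one_smul] at hU
    exact hb (hU ▸ add_mem (add_mem (U.smul_mem α hx) (U.smul_mem β hy)) (U.smul_mem γ hz))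
  rw [hsum, zero_smul] at hU
  by_contra hd0
  have hcases : ∀ α β γ d : ZMod 2, α + β + γ + d = 0 → d ≠ 0 → (α = 1 ∧ β = 0 ∧ γ = 0) ∨
      (α = 0 ∧ β = 1 ∧ γ = 0) ∨ (α = 0 ∧ β = 0 ∧ γ = 1) ∨ (α = 1 ∧ β = 1 ∧ γ = 1) := by
    decide
  rcases hcases α β γ d hsum hd0 with
    ⟨rfl, rfl, rfl⟩ | ⟨rfl, rfl, rfl⟩ | ⟨rfl, rfl, rfl⟩ | ⟨rfl, rfl, rfl⟩ <;>
    simp only [zero_smul, one_smul, add_zero, zero_add] at hU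
  exacts [hx0 hU.symm, hy0 hU.symm, hz0 hU.symm, hxyz hU.symm]

namespace IsDefect

theorem add_add_eq_zero (hθ : IsDefect U b ε θ) (hU : IsTrivialOn U ε) (h : IsKummerCocycle ε)
    (hb : b ∉ U) (hx : x ∈ U) (hy : y ∈ U) (hz : z ∈ U) (hx0 : x ≠ 0) (hy0 : y ≠ 0) (hz0 : z ≠ 0)
    (hxyz : x + y + z ≠ 0) : θ x y + θ y z + θ x z = 0 := by
  set P := Submodule.span (ZMod 2) {(b + x).1, (b + y).1, (b + z).1}
  have hxP : (b + x).1 ∈ P := Submodule.subset_span (by simp)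
  have hyP : (b + y).1 ∈ P := Submodule.subset_span (by simp)
  have hzP : (b + z).1 ∈ P := Submodule.subset_span (by simp)
  have hθP : ∀ s ∈ U, ∀ t ∈ U, (b + s).1 ∈ P → (b + t).1 ∈ P →
      ε (b + s) (b + s + (b + t)) ≡ θ s t • b.1 [SMOD P] := fun s hs t ht hsP htP =>
    ((h.rot (b + s) (b + t)).trans (hθ s hs t ht)).mono (plane_le_iff.2 ⟨hsP, htP⟩)
  have hassoc : ε (b + x) (b + x + (b + y)) + ε (b + y) (b + y + (b + z)) ≡
      ε (b + x) (b + x + (b + z)) + ε (b + x + (b + y)) (b + y + (b + z)) [SMOD P] := by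
    have key := h.assoc (b + x) (b + x + (b + y)) (b + y + (b + z))
    rw [add_add_cancel_left_of_zmod_two, add_assoc (b + x) (b + y),
      add_add_cancel_left_of_zmod_two] at key
    refine key.mono (Submodule.span_le.2 ?_)
    rintro _ (rfl | rfl | rfl)
    exacts [hxP, add_mem hxP hyP, add_mem hyP hzP]
  have hlast : ε (b + x + (b + y)) (b + y + (b + z)) ≡ 0 [SMOD P] := by
    have hmem : ∀ s ∈ U, ∀ t ∈ U, b + s + (b + t) ∈ U := fun s hs t ht => by
      rw [add_add_add_comm, ZModModule.add_self, zero_add]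
      exact add_mem hs ht
    exact SModEq.zero.2 (plane_le_iff.2 ⟨add_mem hxP hyP, add_mem hyP hzP⟩
      (hU _ (hmem x hx y hy) _ (hmem y hy z hz)))
  have hsum := ((hθP x hx y hy hxP hyP).add (hθP y hy z hz hyP hzP)).symm.trans
    (hassoc.trans ((hθP x hx z hz hxP hzP).add hlast))
  rw [add_zero, ← add_smul, smodEq_iff_add_mem, ← add_smul] at hsum
  exact eq_zero_of_smul_mem_span_coset hb hx hy hz hx0 hy0 hz0 hxyz hsum

theorem symm (hθ : IsDefect U b ε θ) (hU : IsTrivialOn U ε) (h : IsKummerCocycle ε)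
    (hb : b ∉ U) (hx : x ∈ U) (hy : y ∈ U) (hx0 : x ≠ 0) (hy0 : y ≠ 0) : θ x y = θ y x := by
  have hxx : θ x x = 0 := by
    have key := hθ.add_add_eq_zero hU h hb hx hx hx hx0 hx0 hx0
      (by rwa [ZModModule.add_self, zero_add])
    rwa [ZModModule.add_self, zero_add] at key
  have key := hθ.add_add_eq_zero hU h hb hx hy hx hx0 hy0 hx0
    (by rwa [add_right_comm, ZModModule.add_self, zero_add])
  rwa [hxx, add_zero, ← ZModModule.sub_eq_add, sub_eq_zero] at key

theorem add_add_eq_zero_of_notMem_span (hθ : IsDefect U b ε θ) (hU : IsTrivialOn U ε)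
    (h : IsKummerCocycle ε) (hb : b ∉ U) (hx : x ∈ U) (hy : y ∈ U) (hx0 : x ≠ 0) (hy0 : y ≠ 0)
    (hxy : x + y ≠ 0) (hz : z ∈ U) (hzxy : z ∉ Submodule.span (ZMod 2) {x, y}) :
    θ x y + θ y (x + y) + θ x (x + y) = 0 := by
  have hxs : x ∈ Submodule.span (ZMod 2) {x, y} := Submodule.subset_span (by simp)
  have hys : y ∈ Submodule.span (ZMod 2) {x, y} := Submodule.subset_span (by simp)
  have ne_of_mem (w : W) (hw : w ∈ Submodule.span (ZMod 2) {x, y}) : w + z ≠ 0 := fun h0 => by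
    rw [← ZModModule.sub_eq_add, sub_eq_zero] at h0
    exact hzxy (h0 ▸ hw)
  have hz0 : z ≠ 0 := fun h0 => hzxy (h0 ▸ zero_mem _)
  have hxyz := hθ.add_add_eq_zero hU h hb hx hy hz hx0 hy0 hz0 (ne_of_mem _ (add_mem hxs hys))
  have hyzs := hθ.add_add_eq_zero hU h hb hy hz (add_mem hx hy) hy0 hz0 hxy (by
    rw [show y + z + (x + y) = x + z from by
      rw [add_comm y, add_comm x, ZModModule.add_add_add_cancel, add_comm]]
    exact ne_of_mem x hxs)
  have hxzs := hθ.add_add_eq_zero hU h hb hx hz (add_mem hx hy) hx0 hz0 hxy (by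
    rw [show x + z + (x + y) = y + z from by
      rw [add_comm x z, ZModModule.add_add_add_cancel, add_comm]]
    exact ne_of_mem y hys)
  linear_combination hxyz + hyzs + hxzs - ZModModule.add_self (θ y z) -
    ZModModule.add_self (θ x z) - ZModModule.add_self (θ z (x + y))

theorem eq_add (hθ : IsDefect U b ε θ) (hU : IsTrivialOn U ε) (h : IsKummerCocycle ε)
    (hb : b ∉ U) (hx₀ : x₀ ∈ U) (hx₀0 : x₀ ≠ 0)
    (hcompl : ∀ x ∈ U, ∀ y ∈ U, x ≠ 0 → y ≠ 0 → x + y = x₀ → θ x y + θ y x₀ + θ x x₀ = 0)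
    (hx : x ∈ U) (hy : y ∈ U) (hx0 : x ≠ 0) (hy0 : y ≠ 0) : θ x y = θ x x₀ + θ y x₀ := by
  have key : θ x y + θ y x₀ + θ x x₀ = 0 := by
    by_cases hxy : x + y = x₀
    · exact hcompl x hx y hy hx0 hy0 hxy
    · refine hθ.add_add_eq_zero hU h hb hx hy hx₀ hx0 hy0 hx₀0 fun h0 => hxy ?_
      rwa [← ZModModule.sub_eq_add, sub_eq_zero] at h0
  linear_combination key - ZModModule.add_self (θ y x₀) - ZModModule.add_self (θ x x₀)

end IsDefect

theorem IsDefect.exists_isTrivialOn (hθ : IsDefect U b ε θ) (hn : IsNormalizedAt U b ε)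
    (h : IsKummerCocycle ε) (hb : b ∉ U) (t : W → ZMod 2)
    (ht : ∀ x ∈ U, ∀ y ∈ U, x ≠ 0 → y ≠ 0 → θ x y = t x + t y) :
    ∃ u : W → V, (∀ x ∈ U, u x = 0) ∧
      IsTrivialOn (Submodule.span (ZMod 2) {b} ⊔ U) (ε + coboundary u) := by
  classical
  let u : W → V := fun p => if p ∈ U then 0 else t (b + p) • b.1
  have hu : ∀ x ∈ U, u x = 0 := fun x hx => if_pos hx
  have hu' : ∀ x ∈ U, u (b + x) = t x • b.1 := fun x hx => by
    simp only [u, if_neg (add_notMem hb hx), add_add_cancel_left_of_zmod_two]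
  have hub : u b = t 0 • b.1 := by simpa using hu' 0 (zero_mem U)
  have hcob : IsNormalizedAt U b (coboundary u) := by
    refine ⟨isTrivialOn_coboundary hu, fun x hx => isTrivialAt_coboundary ?_ ?_ ?_⟩
    · exact hub ▸ Submodule.smul_mem _ _ (left_mem_plane b x)
    · exact hu x hx ▸ zero_mem _
    · exact hu' x hx ▸ Submodule.smul_mem _ _ (left_mem_plane b x)
  refine ⟨u, hu, (hn.add hcob).isTrivialOn_span_singleton_sup
    (h.add_coboundary (hu 0 (zero_mem U))) fun x hx y hy hx0 hy0 _ => ?_⟩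
  have hsum : u (b + x + (b + y)) = 0 := by
    rw [add_add_add_comm, ZModModule.add_self, zero_add]
    exact hu _ (add_mem hx hy)
  have key := hθ x hx y hy
  rw [ht x hx y hy hx0 hy0, add_smul, ← hu' x hx, ← hu' y hy, smodEq_iff_add_mem] at key
  rwa [IsTrivialAt, Pi.add_apply, Pi.add_apply, coboundary, hsum, add_zero]

theorem IsNormalizedAt.isTrivializableOn_span_triple {b₁ b₂ : W}
    (hn : IsNormalizedAt (Submodule.span (ZMod 2) {b₁, b₂}) b ε) (h : IsKummerCocycle ε)
    (hb : b ∉ Submodule.span (ZMod 2) {b₁, b₂}) (hb₁₂ : b₁ ≠ b₂)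
    (hθ : IsDefect (Submodule.span (ZMod 2) {b₁, b₂}) b ε θ)
    (hzero : θ b₁ b₂ + θ b₂ (b₁ + b₂) + θ b₁ (b₁ + b₂) = 0) :
    IsTrivializableOn (Submodule.span (ZMod 2) {b, b₁, b₂}) ε := by
  have hb₁ : b₁ ∈ Submodule.span (ZMod 2) {b₁, b₂} := Submodule.subset_span (by simp)
  have hb₂ : b₂ ∈ Submodule.span (ZMod 2) {b₁, b₂} := Submodule.subset_span (by simp)
  have hb₁₂0 : b₁ + b₂ ≠ 0 := by rwa [← ZModModule.sub_eq_add, sub_ne_zero]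
  have hcompl : ∀ x ∈ Submodule.span (ZMod 2) {b₁, b₂}, ∀ y ∈ Submodule.span (ZMod 2) {b₁, b₂},
      x ≠ 0 → y ≠ 0 → x + y = b₁ + b₂ → θ x y + θ y (b₁ + b₂) + θ x (b₁ + b₂) = 0 := by
    intro x hx y _ hx0 hy0 hxy
    obtain ⟨α, β, rfl⟩ := Submodule.mem_span_pair.1 hx
    obtain rfl | rfl := zmod_two_eq_zero_or_one α <;>
      obtain rfl | rfl := zmod_two_eq_zero_or_one β <;>
      simp only [zero_smul, one_smul, zero_add, add_zero] at hx0 hxy ⊢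
    · exact absurd rfl hx0
    · obtain rfl : y = b₁ := by rwa [add_comm, add_left_inj] at hxy
      rw [hθ.symm hn.isTrivialOn h hb hb₂ hb₁ hx0 hy0, add_right_comm]
      exact hzero
    · obtain rfl : y = b₂ := add_left_cancel hxy
      exact hzero
    · exact absurd (add_eq_left.1 hxy) hy0
  obtain ⟨u, hu, htriv⟩ := hθ.exists_isTrivialOn hn h hb (fun x => θ x (b₁ + b₂))
    fun x hx y hy => hθ.eq_add hn.isTrivialOn h hb (add_mem hb₁ hb₂) hb₁₂0 hcompl hx hy
  rw [Submodule.span_insert]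
  exact ⟨u, hu 0 (zero_mem _), htriv⟩

theorem IsKummerCocycle.exists_isNormalizedAt_span_pair (h : IsKummerCocycle ε) {b₁ b₂ : W}
    (hb : b ∉ Submodule.span (ZMod 2) {b₁, b₂}) :
    ∃ u : W → V, u 0 = 0 ∧
      IsNormalizedAt (Submodule.span (ZMod 2) {b₁, b₂}) b (ε + coboundary u) := by
  obtain ⟨u, hu, htriv⟩ := h.isTrivializableOn_span_pair b₁ b₂
  obtain ⟨u', hu', hn⟩ := htriv.exists_isNormalizedAt (h.add_coboundary hu) hb
  refine ⟨u + u', ?_, ?_⟩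
  · rw [Pi.add_apply, hu, hu' 0 (zero_mem _), add_zero]
  · rwa [coboundary_add, ← add_assoc]

theorem IsKummerCocycle.isTrivializableOn_span_triple_or (h : IsKummerCocycle ε)
    (h' : IsKummerCocycle ε') {b₁ b₂ : W} (hb : b ∉ Submodule.span (ZMod 2) {b₁, b₂})
    (hb₁₂ : b₁ ≠ b₂) :
    IsTrivializableOn (Submodule.span (ZMod 2) {b, b₁, b₂}) ε ∨
      IsTrivializableOn (Submodule.span (ZMod 2) {b, b₁, b₂}) ε' ∨
      IsTrivializableOn (Submodule.span (ZMod 2) {b, b₁, b₂}) (ε + ε') := by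
  obtain ⟨u, hu, hn⟩ := h.exists_isNormalizedAt_span_pair hb
  obtain ⟨u', hu', hn'⟩ := h'.exists_isNormalizedAt_span_pair hb
  replace h := h.add_coboundary hu
  replace h' := h'.add_coboundary hu'
  obtain ⟨θ, hθ⟩ := hn.exists_isDefect h
  obtain ⟨θ', hθ'⟩ := hn'.exists_isDefect h'
  obtain hzero | hone := zmod_two_eq_zero_or_one (θ b₁ b₂ + θ b₂ (b₁ + b₂) + θ b₁ (b₁ + b₂))
  · exact .inl (.of_add_coboundary hu (hn.isTrivializableOn_span_triple h hb hb₁₂ hθ hzero))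
  obtain hzero' | hone' :=
    zmod_two_eq_zero_or_one (θ' b₁ b₂ + θ' b₂ (b₁ + b₂) + θ' b₁ (b₁ + b₂))
  · exact .inr (.inl (.of_add_coboundary hu'
      (hn'.isTrivializableOn_span_triple h' hb hb₁₂ hθ' hzero')))
  have hsum := (hn.add hn').isTrivializableOn_span_triple (h.add h') hb hb₁₂ (hθ.add hθ') (by
    simp only [Pi.add_apply]
    linear_combination hone + hone' + ZModModule.add_self (1 : ZMod 2))
  rw [add_add_add_comm, ← coboundary_add] at hsum
  exact .inr (.inr (.of_add_coboundary (by rw [Pi.add_apply, hu, hu', add_zero]) hsum))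

theorem IsTrivialOn.exists_isTrivialOn_span_singleton_sup (hU : IsTrivialOn U ε)
    (h : IsKummerCocycle ε) (hb : b ∉ U)
    (hrank : ∀ x y : W, ∃ s ∈ U, s ∉ Submodule.span (ZMod 2) {x, y}) :
    ∃ u : W → V, (∀ x ∈ U, u x = 0) ∧
      IsTrivialOn (Submodule.span (ZMod 2) {b} ⊔ U) (ε + coboundary u) := by
  obtain ⟨u, hu, hn⟩ := hU.exists_isNormalizedAt h hb
  have h' := h.add_coboundary (hu 0 (zero_mem U))
  obtain ⟨θ, hθ⟩ := hn.exists_isDefect h'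
  obtain ⟨x₀, hx₀, hx₀0⟩ := hrank 0 0
  replace hx₀0 : x₀ ≠ 0 := by
    rintro rfl
    exact hx₀0 (zero_mem _)
  have hcompl : ∀ x ∈ U, ∀ y ∈ U, x ≠ 0 → y ≠ 0 → x + y = x₀ →
      θ x y + θ y x₀ + θ x x₀ = 0 := by
    rintro x hx y hy hx0 hy0 rfl
    obtain ⟨z, hz, hzxy⟩ := hrank x y
    exact hθ.add_add_eq_zero_of_notMem_span hn.isTrivialOn h' hb hx hy hx0 hy0 hx₀0 hz hzxy
  obtain ⟨u', hu', htriv⟩ := hθ.exists_isTrivialOn hn h' hb (fun x => θ x x₀)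
    fun x hx y hy => hθ.eq_add hn.isTrivialOn h' hb hx₀ hx₀0 hcompl hx hy
  refine ⟨u + u', fun x hx => ?_, ?_⟩
  · rw [Pi.add_apply, hu x hx, hu' x hx, add_zero]
  · rwa [coboundary_add, ← add_assoc]

/-- `Γ` is the graph of a change of representatives on a subgroup of `W` that makes `ε` trivial
there. Graphs are used because Zorn's lemma applies to them directly. -/
structure IsTrivializationGraph (ε : W → W → V) (Γ : Set (W × V)) : Prop where
  injOn : Set.InjOn Prod.fst Γ
  exists_add : ∀ p ∈ Γ, ∀ q ∈ Γ, ∃ r ∈ Γ, r.1 = p.1 + q.1 ∧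
    ε p.1 q.1 + (p.2 + q.2 + r.2) ∈ plane p.1 q.1

theorem IsTrivialOn.isTrivializationGraph {u : W → V} (hU : IsTrivialOn U (ε + coboundary u)) :
    IsTrivializationGraph ε ((U : Set W).graphOn u) where
  injOn := by
    rintro _ ⟨x, -, rfl⟩ _ ⟨y, -, rfl⟩ (rfl : x = y)
    rfl
  exists_add := by
    rintro _ ⟨x, hx, rfl⟩ _ ⟨y, hy, rfl⟩
    exact ⟨_, ⟨x + y, add_mem hx hy, rfl⟩, rfl, hU x hx y hy⟩

theorem IsTrivializationGraph.exists_graphOn_eq {Γ : Set (W × V)}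
    (hΓ : IsTrivializationGraph ε Γ) (hzero : (0, 0) ∈ Γ) :
    ∃ (D : Submodule (ZMod 2) W) (u : W → V), u 0 = 0 ∧ (D : Set W).graphOn u = Γ ∧
      IsTrivialOn D (ε + coboundary u) := by
  obtain ⟨u, hu⟩ := Set.exists_eq_graphOn_image_fst.2 hΓ.injOn
  have mem_iff {x : W} {v : V} : (x, v) ∈ Γ ↔ x ∈ Prod.fst '' Γ ∧ u x = v := by
    conv_lhs => rw [hu, Set.mem_graphOn]
  have hadd : ∀ x ∈ Prod.fst '' Γ, ∀ y ∈ Prod.fst '' Γ,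
      x + y ∈ Prod.fst '' Γ ∧ IsTrivialAt (ε + coboundary u) x y := by
    intro x hx y hy
    obtain ⟨⟨z, v⟩, hr, rfl, hmem⟩ :=
      hΓ.exists_add _ (mem_iff.2 ⟨hx, rfl⟩) _ (mem_iff.2 ⟨hy, rfl⟩)
    obtain ⟨hxy, rfl⟩ := mem_iff.1 hr
    exact ⟨hxy, hmem⟩
  let D : AddSubgroup W :=
    { carrier := Prod.fst '' Γ
      zero_mem' := ⟨_, hzero, rfl⟩
      add_mem' := fun hx hy => (hadd _ hx _ hy).1
      neg_mem' := fun {x} hx => by rwa [ZModModule.neg_eq_self] }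
  exact ⟨AddSubgroup.toZModSubmodule 2 D, u, (mem_iff.1 hzero).2, hu.symm,
    fun x hx y hy => (hadd x hx y hy).2⟩

theorem IsTrivializationGraph.sUnion {C : Set (Set (W × V))}
    (hC : ∀ Γ ∈ C, IsTrivializationGraph ε Γ) (hchain : IsChain (· ⊆ ·) C) :
    IsTrivializationGraph ε (⋃₀ C) := by
  have directed : ∀ p ∈ ⋃₀ C, ∀ q ∈ ⋃₀ C, ∃ Γ ∈ C, p ∈ Γ ∧ q ∈ Γ := by
    rintro p ⟨Γ, hΓ, hp⟩ q ⟨Γ', hΓ', hq⟩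
    obtain hle | hle := hchain.total hΓ hΓ'
    · exact ⟨Γ', hΓ', hle hp, hq⟩
    · exact ⟨Γ, hΓ, hp, hle hq⟩
  refine ⟨fun p hp q hq hpq => ?_, fun p hp q hq => ?_⟩
  · obtain ⟨Γ, hΓ, hp, hq⟩ := directed p hp q hq
    exact (hC Γ hΓ).injOn hp hq hpq
  · obtain ⟨Γ, hΓ, hp, hq⟩ := directed p hp q hq
    obtain ⟨r, hr, hpqr⟩ := (hC Γ hΓ).exists_add p hp q hq
    exact ⟨r, ⟨Γ, hΓ, hr⟩, hpqr⟩

theorem IsTrivialOn.isTrivializableOn_top (hU : IsTrivialOn U ε) (h : IsKummerCocycle ε)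
    (hrank : ∀ x y : W, ∃ s ∈ U, s ∉ Submodule.span (ZMod 2) {x, y}) :
    IsTrivializableOn ⊤ ε := by
  have hΓ₀ : IsTrivializationGraph ε ((U : Set W).graphOn 0) :=
    (hU.add (isTrivialOn_coboundary fun _ _ => rfl)).isTrivializationGraph
  obtain ⟨Γ, hUΓ, hmax⟩ := zorn_subset_nonempty {Γ | IsTrivializationGraph ε Γ}
    (fun C hC hchain _ => ⟨⋃₀ C, .sUnion hC hchain, fun _ => Set.subset_sUnion_of_mem⟩) _ hΓ₀
  obtain ⟨D, u, hu, rfl, hD⟩ := hmax.prop.exists_graphOn_eq (hUΓ ⟨0, zero_mem U, rfl⟩)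
  have hUD : U ≤ D := fun x hx => (Set.mem_graphOn.1 (hUΓ ⟨x, hx, rfl⟩)).1
  suffices hD_top : D = ⊤ from ⟨u, hu, hD_top ▸ hD⟩
  refine Submodule.eq_top_iff'.2 fun b => ?_
  by_contra hb
  obtain ⟨u', hu', hD'⟩ := hD.exists_isTrivialOn_span_singleton_sup (h.add_coboundary hu) hb
    fun x y => (hrank x y).imp fun s hs => ⟨hUD hs.1, hs.2⟩
  rw [add_assoc, ← coboundary_add] at hD'
  have hle : (D : Set W).graphOn u ⊆
      ((Submodule.span (ZMod 2) {b} ⊔ D : Submodule (ZMod 2) W) : Set W).graphOn (u + u') := by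
    rintro _ ⟨x, hx, rfl⟩
    exact ⟨x, Submodule.mem_sup_right hx, by simp [hu' x hx]⟩
  have hbΓ := hmax.le_of_ge hD'.isTrivializationGraph hle
    ⟨b, Submodule.mem_sup_left (Submodule.mem_span_singleton_self b), rfl⟩
  exact hb (Set.mem_graphOn.1 hbΓ).1

theorem IsTrivializableOn.top (hU : IsTrivializableOn U ε) (h : IsKummerCocycle ε)
    (hrank : ∀ x y : W, ∃ s ∈ U, s ∉ Submodule.span (ZMod 2) {x, y}) :
    IsTrivializableOn ⊤ ε := by
  obtain ⟨u, hu, hU⟩ := hU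
  exact .of_add_coboundary hu (hU.isTrivializableOn_top (h.add_coboundary hu) hrank)

end Trivializable

theorem exists_linearIndependent_triple {k M : Type*} [DivisionRing k] [AddCommGroup M]
    [Module k M] {X : Submodule k M} (hX : Module.finrank k X = 3) :
    ∃ b b₁ b₂ : M, LinearIndependent k ![b, b₁, b₂] ∧ Submodule.span k {b, b₁, b₂} = X := by
  have : Module.Finite k X := Module.finite_of_finrank_pos (by lia)
  let B := Module.finBasisOfFinrankEq k X hX
  have hB : X.subtype ∘ B = ![(B 0).1, (B 1).1, (B 2).1] := by
    ext i
    fin_cases i <;> rfl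
  refine ⟨B 0, B 1, B 2, hB ▸ B.linearIndependent.map' X.subtype X.ker_subtype, ?_⟩
  have hrange : {(B 0).1, (B 1).1, (B 2).1} = X.subtype '' Set.range B := by
    simp only [← Set.range_comp, hB, Matrix.range_cons, Matrix.range_empty, Set.union_empty,
      Set.singleton_union]
  rw [hrange, Submodule.span_image, B.span_eq, Submodule.map_subtype_top]

theorem exists_dual_family {k M ι : Type*} [Field k] [AddCommGroup M] [Module k M] [DecidableEq ι]
    {v : ι → M} (hv : LinearIndependent k v) :
    ∃ c : ι → M →ₗ[k] k, ∀ i j, c i (v j) = if i = j then 1 else 0 := by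
  obtain ⟨g, hg⟩ := (Finsupp.linearCombination k v).exists_leftInverse_of_injective
    (LinearMap.ker_eq_bot.2 hv)
  refine ⟨fun i => Finsupp.lapply i ∘ₗ g, fun i j => ?_⟩
  have hgv : g (v j) = Finsupp.single j 1 := by
    simpa [Finsupp.linearCombination_single] using LinearMap.congr_fun hg (Finsupp.single j 1)
  simp [hgv, Finsupp.single_apply, eq_comm]

theorem exists_mem_notMem_span_pair {k M : Type*} [DivisionRing k] [AddCommGroup M]
    [Module k M] {X : Submodule k M} (hX : 2 < Module.finrank k X) (x y : M) :
    ∃ s ∈ X, s ∉ Submodule.span k {x, y} := by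
  classical
  by_contra! hle
  have : Module.Finite k (Submodule.span k {x, y}) := .span_of_finite k (Set.toFinite _)
  have hpair : Module.finrank k (Submodule.span k {x, y}) ≤ 2 := by
    have key := finrank_span_finset_le_card (R := k) {x, y}
    rw [Finset.coe_pair] at key
    exact key.trans Finset.card_le_two
  exact (hX.trans_le (Submodule.finrank_mono hle)).not_ge hpair

theorem finrank_span_pair_eq_two {M : Type*} [AddCommGroup M] [Module (ZMod 2) M] {x y : M}
    (hx : x ≠ 0) (hy : y ≠ 0) (hxy : x ≠ y) :
    Module.finrank (ZMod 2) (Submodule.span (ZMod 2) {x, y}) = 2 := by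
  have hli : LinearIndependent (ZMod 2) ![x, y] := by
    rw [LinearIndependent.pair_iff' hx]
    intro a
    obtain rfl | rfl := zmod_two_eq_zero_or_one a
    · rw [zero_smul]
      exact hy.symm
    · rwa [one_smul]
  rw [← Matrix.range_cons_cons_empty x y ![]]
  exact finrank_span_eq_card hli

theorem exists_finrank_eq_of_le_rank {k M : Type*} [DivisionRing k] [AddCommGroup M] [Module k M]
    {n : ℕ} (hn : n ≤ Module.rank k M) : ∃ X : Submodule k M, Module.finrank k X = n := by
  obtain ⟨v, hv⟩ := Module.le_rank_iff.1 hn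
  exact ⟨_, (finrank_span_eq_card hv).trans (Fintype.card_fin n)⟩

theorem rank_le_two_or_exists_finrank_eq_three {k M : Type*} [DivisionRing k] [AddCommGroup M]
    [Module k M] : Module.rank k M ≤ 2 ∨
      ¬ Module.rank k M ≤ 2 ∧ ∃ X : Submodule k M, Module.finrank k X = 3 := by
  refine (em _).imp_right fun hrank => ⟨hrank, exists_finrank_eq_of_le_rank ?_⟩
  have h3 : ((2 + 1 : ℕ) : Cardinal) ≤ Module.rank k M := by
    rw [Nat.cast_add_one, Cardinal.natCast_add_one_le_iff]
    exact_mod_cast not_le.1 hrank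
  exact h3

theorem exists_span_pair_eq_top {k M : Type*} [DivisionRing k] [AddCommGroup M] [Module k M]
    (hrank : Module.rank k M ≤ 2) : ∃ b c : M, Submodule.span k {b, c} = ⊤ := by
  by_contra! hne
  have hnotMem (b c : M) : ∃ d, d ∉ Submodule.span k {b, c} := by
    simpa using mt Submodule.eq_top_iff'.2 (hne b c)
  obtain ⟨b, hb⟩ := hnotMem 0 0
  obtain ⟨c, hc⟩ := hnotMem b b
  obtain ⟨d, hd⟩ := hnotMem b c
  have hli : LinearIndependent k ![d, c, b] := by
    refine linearIndependent_finCons.2 ⟨linearIndependent_finCons.2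
      ⟨linearIndependent_unique_iff.2 ?_, ?_⟩, ?_⟩ <;> simp_all
  have h3 := (Module.le_rank_iff.2 ⟨_, hli⟩).trans hrank
  norm_num at h3

theorem IsKummerCocycle.isTrivializableOn_top {ε : W → W → V} (h : IsKummerCocycle ε)
    (hrank : Module.rank (ZMod 2) W ≤ 2) : IsTrivializableOn ⊤ ε := by
  obtain ⟨b, c, hbc⟩ := exists_span_pair_eq_top hrank
  exact hbc ▸ h.isTrivializableOn_span_pair b c

section RankThree

variable {X : Submodule (ZMod 2) W} {ε ε' : W → W → V}

theorem IsKummerCocycle.isTrivializableOn_or (h : IsKummerCocycle ε) (h' : IsKummerCocycle ε')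
    (hX : Module.finrank (ZMod 2) X = 3) :
    IsTrivializableOn X ε ∨ IsTrivializableOn X ε' ∨ IsTrivializableOn X (ε + ε') := by
  obtain ⟨b, b₁, b₂, hli, rfl⟩ := exists_linearIndependent_triple hX
  have hb : b ∉ Submodule.span (ZMod 2) {b₁, b₂} := by
    simpa [Set.pair_comm] using (linearIndependent_finCons.1 hli).2
  exact h.isTrivializableOn_span_triple_or h' hb (hli.injective.ne (by decide : (1 : Fin 3) ≠ 2))

theorem IsKummerCocycle.isTrivializableOn_iff_top (h : IsKummerCocycle ε)
    (hX : Module.finrank (ZMod 2) X = 3) : IsTrivializableOn X ε ↔ IsTrivializableOn ⊤ ε := by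
  refine ⟨fun htriv => htriv.top h (exists_mem_notMem_span_pair (by lia)), ?_⟩
  rintro ⟨u, hu, htriv⟩
  exact ⟨u, hu, fun x _ y _ => htriv x trivial y trivial⟩

end RankThree

/-- `S` is a normalised symmetric 2-cocycle, as it arises from an extension of `W` by `V`. -/
structure IsSymmCocycle (S : W → W → V) : Prop where
  zero (x) : S x 0 = 0
  comm (x y) : S x y = S y x
  assoc (x y z) : S x y + S (x + y) z = S x (y + z) + S y z

/-- `S` is a normalised symmetric 2-cocycle such that doubling in the corresponding extension of
`W` by `V` is the projection to `W` followed by the inclusion of `W` into `V`. -/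
structure IsDoublingCocycle (S : W → W → V) : Prop extends IsSymmCocycle S where
  self (x) : S x x = x.1

theorem isSymmCocycle_zero : IsSymmCocycle (0 : W → W → V) :=
  ⟨fun _ => rfl, fun _ _ => rfl, fun _ _ _ => rfl⟩

section DoublingCocycle

variable {S : W → W → V}

theorem IsSymmCocycle.zero_left (hS : IsSymmCocycle S) (x : W) : S 0 x = 0 := by
  rw [hS.comm, hS.zero]

theorem exists_isDoublingCocycle (W : Submodule (ZMod 2) V) :
    ∃ S : W → W → V, IsDoublingCocycle S := by
  let B := Module.Basis.ofVectorSpace (ZMod 2) W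
  let mul : W → W → W := fun x y => B.repr.symm (B.repr x * B.repr y)
  have comm (x y : W) : mul x y = mul y x := by simp only [mul, mul_comm]
  have add_mul (x y z : W) : mul (x + y) z = mul x z + mul y z := by
    simp only [mul, map_add, _root_.add_mul]
  have self (x : W) : mul x x = x := by
    rw [LinearEquiv.symm_apply_eq]
    ext i
    exact (by decide : ∀ a : ZMod 2, a * a = a) _
  refine ⟨fun x y => mul x y, ⟨fun x => ?_, fun x y => by rw [comm], fun x y z => ?_⟩,
    fun x => by rw [self]⟩
  · simp [mul]
  · rw [comm x (y + z), add_mul, add_mul, comm y x, comm z x, ← Submodule.coe_add,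
      ← Submodule.coe_add, add_assoc]

theorem IsDoublingCocycle.add_right (hS : IsDoublingCocycle S) (x y : W) :
    S x (x + y) = x.1 + S x y := by
  have key := hS.assoc x x y
  rw [hS.self, ZModModule.add_self, hS.zero_left, add_zero] at key
  rw [key, add_assoc, ZModModule.add_self, add_zero]

theorem IsDoublingCocycle.isKummerCocycle (hS : IsDoublingCocycle S) : IsKummerCocycle S where
  zero x := hS.zero x ▸ zero_mem _
  swap x y := hS.comm x y ▸ SModEq.rfl
  rot x y := by
    rw [hS.add_right, smodEq_iff_add_mem, add_assoc, ZModModule.add_self, add_zero]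
    exact left_mem_plane x y
  assoc x y z := hS.assoc x y z ▸ SModEq.rfl

theorem IsDoublingCocycle.add_coboundary (hS : IsDoublingCocycle S) {u : W → V} (hu : u 0 = 0) :
    IsDoublingCocycle (S + coboundary u) where
  zero x := by simp [coboundary, hS.zero, hu, ZModModule.add_self]
  comm x y := by simp only [Pi.add_apply, coboundary, hS.comm x y, add_comm]
  assoc x y z := by
    have key := congrArg₂ (· + ·) (hS.assoc x y z) (coboundary_assoc u x y z)
    rwa [add_add_add_comm, add_add_add_comm (S x (y + z))] at key
  self x := by
    simp [coboundary, hS.self, hu, ZModModule.add_self]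

theorem IsTrivialAt.apply_eq_zero {ε : W → W → V} {x y : W} (h : IsTrivialAt ε x y)
    (f : V →ₗ[ZMod 2] ZMod 2) (hx : f x = 0) (hy : f y = 0) : f (ε x y) = 0 :=
  plane_le_iff (P := LinearMap.ker f).2 ⟨hx, hy⟩ h

theorem IsDoublingCocycle.not_isTrivialOn_span_triple (hS : IsDoublingCocycle S) {b₁ b₂ b₃ : W}
    (hli : LinearIndependent (ZMod 2) ![b₁, b₂, b₃]) :
    ¬ IsTrivialOn (Submodule.span (ZMod 2) {b₁, b₂, b₃}) S := fun htriv => by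
  obtain ⟨c, hc⟩ := exists_dual_family (hli.map' W.subtype W.ker_subtype)
  obtain ⟨⟨c₁₁, c₁₂, c₁₃⟩, ⟨c₂₁, c₂₂, c₂₃⟩, c₃₁, c₃₂, c₃₃⟩ :
      (c 0 b₁ = 1 ∧ c 0 b₂ = 0 ∧ c 0 b₃ = 0) ∧ (c 1 b₁ = 0 ∧ c 1 b₂ = 1 ∧ c 1 b₃ = 0) ∧
        (c 2 b₁ = 0 ∧ c 2 b₂ = 0 ∧ c 2 b₃ = 1) := by
    simpa [Fin.forall_fin_succ] using hc
  have hb₁ : b₁ ∈ Submodule.span (ZMod 2) {b₁, b₂, b₃} := Submodule.subset_span (by simp)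
  have hb₂ : b₂ ∈ Submodule.span (ZMod 2) {b₁, b₂, b₃} := Submodule.subset_span (by simp)
  have hb₃ : b₃ ∈ Submodule.span (ZMod 2) {b₁, b₂, b₃} := Submodule.subset_span (by simp)
  have h₂₃ := (htriv b₂ hb₂ b₃ hb₃).apply_eq_zero (c 0) c₁₂ c₁₃
  have h₁₃ := (htriv b₁ hb₁ b₃ hb₃).apply_eq_zero (c 1) c₂₁ c₂₃
  have h₁₂ := (htriv b₁ hb₁ b₂ hb₂).apply_eq_zero (c 2) c₃₁ c₃₂
  have h₁₂_₃ := (htriv _ (add_mem hb₁ hb₂) b₃ hb₃).apply_eq_zero (c 0 + c 1)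
    (by simp [*, CharTwo.add_self_eq_zero]) (by simp [*])
  have h₁₃_₂ := (htriv _ (add_mem hb₁ hb₃) b₂ hb₂).apply_eq_zero (c 0 + c 2)
    (by simp [*, CharTwo.add_self_eq_zero]) (by simp [*])
  have h₁_₂₃ := (htriv b₁ hb₁ _ (add_mem hb₂ hb₃)).apply_eq_zero (c 1 + c 2)
    (by simp [*]) (by simp [*, CharTwo.add_self_eq_zero])
  have h₁₂_₂₃ := (htriv _ (add_mem hb₁ hb₂) _ (add_mem hb₂ hb₃)).apply_eq_zero
    (c 0 + c 1 + c 2) (by simp [*, CharTwo.add_self_eq_zero])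
    (by simp [*, CharTwo.add_self_eq_zero])
  have s₁₂_₃ (i : Fin 3) := congrArg (c i) (hS.assoc b₁ b₂ b₃)
  have s₁₃_₂ (i : Fin 3) := congrArg (c i) (hS.assoc b₁ b₃ b₂)
  have s₁₂_₂₃ (i : Fin 3) := congrArg (c i) (hS.assoc b₁ b₂ (b₂ + b₃))
  rw [add_comm b₃, hS.comm b₃] at s₁₃_₂
  rw [add_add_cancel_left_of_zmod_two, hS.add_right] at s₁₂_₂₃
  simp only [map_add, LinearMap.add_apply] at *
  -- The sum of the equations at the seven planes in `⟨b₁, b₂, b₃⟩` is `c 1 b₂ = 0`.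
  grind

theorem IsDoublingCocycle.not_isTrivializableOn (hS : IsDoublingCocycle S)
    {X : Submodule (ZMod 2) W} (hX : Module.finrank (ZMod 2) X = 3) : ¬ IsTrivializableOn X S := by
  rintro ⟨u, hu, htriv⟩
  obtain ⟨b₁, b₂, b₃, hli, rfl⟩ := exists_linearIndependent_triple hX
  exact (hS.add_coboundary hu).not_isTrivialOn_span_triple hli htriv

end DoublingCocycle

end Pairings

section Representatives

variable {K : Type u} [KummerStructure K]

theorem act_mem_κ_act_left {a b c : K} (h : c ∈ κ s(a, b)) (u : TwoTorsion K) :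
    act c u ∈ κ s(act a u, b) := by
  obtain ⟨d, hd⟩ := h
  have ha : κ s(u.1, a) = s(act a u, act a u) := by rw [Sym2.eq_swap, κ_act]
  obtain ⟨s₀, s₁, s₂, s₃, hs, -, hs', -⟩ := κ_assoc' ha ((congrArg κ Sym2.eq_swap).trans hd)
  rw [Sym2.eq_swap] at hs hs'
  rw [hs', ← eq_act_of_κ hs]
  exact Sym2.mem_mk_left _ _

theorem act_mem_κ_act {a b c : K} (h : c ∈ κ s(a, b)) (u v : TwoTorsion K) :
    act c (u + v) ∈ κ s(act a u, act b v) := by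
  rw [act_add, Sym2.eq_swap]
  refine act_mem_κ_act_left ?_ v
  rw [Sym2.eq_swap]
  exact act_mem_κ_act_left h u

theorem act_act_self (a : K) (u : TwoTorsion K) : act (act a u) u = a := by
  rw [← act_add, ZModModule.add_self, act_zero]

theorem act_mem_κ_right_iff {a b c : K} (u : TwoTorsion K) :
    act c u ∈ κ s(a, b) ↔ c ∈ κ s(a, act b u) := by
  constructor <;> intro h
  · simpa only [act_zero, zero_add, act_act_self] using act_mem_κ_act h 0 u
  · simpa only [act_zero, zero_add, act_act_self] using act_mem_κ_act h 0 u

theorem TwoTorsion.val_inj {u v : TwoTorsion K} : u.1 = v.1 ↔ u = v :=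
  Subtype.ext_iff.symm

theorem act_eq_act_iff {a : K} {w u v : TwoTorsion K} (ha : dbl a = w.1) :
    act a u = act a v ↔ v = u ∨ v = u + w := by
  have key : act a u = act a v ↔ a = act a (u + v) := by
    constructor <;> intro h
    · rw [act_add, h, act_act_self]
    · rw [h, ← act_add, add_right_comm, ZModModule.add_self, zero_add, ← h]
  rw [key, eq_act_iff, mem_κ_comm, κ_self, ha, Sym2.mem_iff]
  refine (or_congr (TwoTorsion.val_inj (v := 0)) TwoTorsion.val_inj).trans ?_
  grind [ZModModule.add_self u]

theorem nonempty_reps : Nonempty (Reps K) := by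
  classical
  choose f hf using fun x : twoK K => (x.2 : ∃ a : K, dbl a = x.1.1)
  refine ⟨⟨fun x => if x = 0 then zero else f x, fun x => ?_, if_pos rfl⟩⟩
  split_ifs with hx
  · rw [hx]
    exact dbl_zero
  · exact hf x

namespace Reps

/-- `ε` is a lift to `K[2]` of the pairing attached to the representatives `r`. -/
def IsEpsLift (r : Reps K) (ε : twoK K → twoK K → TwoTorsion K) : Prop :=
  ∀ x y, r.eps x y = Submodule.Quotient.mk (ε x y)

theorem exists_isEpsLift (r : Reps K) : ∃ ε, r.IsEpsLift ε :=
  ⟨fun x y => (r.eps x y).out, fun _ _ => (Quotient.out_eq _).symm⟩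

/-- The representatives `e_x + u x`. -/
noncomputable def translate (r : Reps K) {u : twoK K → TwoTorsion K} (hu : u 0 = 0) :
    Reps K where
  e x := act (r.e x) (u x)
  dbl_e x := (dbl_act _ _).trans (r.dbl_e x)
  e_zero := by rw [hu, act_zero, r.e_zero]

theorem exists_translate_eq (r r' : Reps K) :
    ∃ (u : twoK K → TwoTorsion K) (hu : u 0 = 0), r.translate hu = r' := by
  have hdbl (x : twoK K) : dbl (r.e x) = dbl (r'.e x) := (r.dbl_e x).trans (r'.dbl_e x).symm
  choose u hu using fun x => exists_eq_act (hdbl x) (by rw [r.dbl_e]; exact x.1.2)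
  have hu0 : (0 + u 0).1 = (0 : TwoTorsion K).1 := by
    refine Eq.trans ?_ r'.e_zero
    rw [hu, r.e_zero]
    rfl
  refine ⟨u, by rwa [TwoTorsion.val_inj, zero_add] at hu0, ?_⟩
  cases r'
  rw [translate, mk.injEq]
  exact funext fun x => (hu x).symm

namespace IsEpsLift

variable {r : Reps K} {ε : twoK K → twoK K → TwoTorsion K} (h : r.IsEpsLift ε)
include h

theorem act_mem_κ_iff (x y : twoK K) (v : TwoTorsion K) :
    act (r.e (x + y)) v ∈ κ s(r.e x, r.e y) ↔ ε x y ≡ v [SMOD plane x y] := by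
  rw [← r.eps_eq_mk_iff, h x y]
  rfl

theorem act_mem_κ (x y : twoK K) : act (r.e (x + y)) (ε x y) ∈ κ s(r.e x, r.e y) :=
  (h.act_mem_κ_iff x y _).2 rfl

theorem smodEq_swap (x y : twoK K) : ε x y ≡ ε y x [SMOD plane x y] := by
  rw [← h.act_mem_κ_iff, add_comm, Sym2.eq_swap]
  exact h.act_mem_κ y x

theorem smodEq_assoc (x y z : twoK K) : ε x y + ε (x + y) z ≡ ε x (y + z) + ε y z
    [SMOD Submodule.span (ZMod 2) {x.1, y.1, z.1}] := by
  obtain ⟨p, hp⟩ := h.act_mem_κ x y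
  obtain ⟨q, hq⟩ := h.act_mem_κ y z
  obtain ⟨s, s₁, s₂, s₃, hs, -, hs', -⟩ := κ_assoc' hp ((congrArg κ Sym2.eq_swap).trans hq)
  have hx : s ∈ κ s(r.e x, act (r.e (y + z)) (ε y z)) := hs ▸ Sym2.mem_mk_left _ _
  have hz : s ∈ κ s(r.e z, act (r.e (x + y)) (ε x y)) := hs' ▸ Sym2.mem_mk_left _ _
  have hdbl : dbl (r.e (x + (y + z))) = dbl s :=
    (r.dbl_e _).trans (dbl_eq_add (r.dbl_e x) ((dbl_act _ _).trans (r.dbl_e (y + z))) hx).symm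
  obtain ⟨w, rfl⟩ := exists_eq_act hdbl (by rw [r.dbl_e]; exact (x + (y + z)).1.2)
  rw [← act_mem_κ_right_iff, ← act_add] at hx hz
  rw [h.act_mem_κ_iff] at hx
  rw [Sym2.eq_swap, ← add_assoc, h.act_mem_κ_iff] at hz
  have hmem : {x.1, y.1, z.1} ⊆ (Submodule.span (ZMod 2) {x.1, y.1, z.1} : Set (TwoTorsion K)) :=
    Submodule.subset_span
  simp only [Set.insert_subset_iff, Set.singleton_subset_iff, SetLike.mem_coe] at hmem
  obtain ⟨hx', hy', hz'⟩ := hmem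
  replace hx := hx.mono (plane_le_iff.2 ⟨hx', add_mem hy' hz'⟩)
  replace hz := hz.mono (plane_le_iff.2 ⟨add_mem hx' hy', hz'⟩)
  rw [smodEq_iff_add_mem (V := TwoTorsion K)] at hx hz ⊢
  convert add_mem hx hz using 1
  grind [ZModModule.add_self w]

theorem isKummerCocycle : IsKummerCocycle ε where
  zero x := by
    rw [← SModEq.zero, ← h.act_mem_κ_iff, act_zero, add_zero, r.e_zero, κ_zero]
    exact Sym2.mem_mk_left _ _
  swap := h.smodEq_swap
  rot x y := by
    rw [← plane_add_right, ← h.act_mem_κ_iff, add_add_cancel_left_of_zmod_two,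
      act_mem_κ_right_iff, ← mem_κ_comm]
    exact h.act_mem_κ x y
  assoc := h.smodEq_assoc

theorem translate {u : twoK K → TwoTorsion K} (hu : u 0 = 0) :
    (r.translate hu).IsEpsLift (ε + coboundary u) := fun x y => by
  refine ((r.translate hu).eps_eq_mk_iff x y _).2 ?_
  have key : act (act (r.e (x + y)) (u (x + y))) ((ε + coboundary u) x y) =
      act (act (r.e (x + y)) (ε x y)) (u x + u y) := by
    rw [← act_add, ← act_add, Pi.add_apply, Pi.add_apply, coboundary]
    congr 1
    grind [ZModModule.add_self (u (x + y))]
  exact key ▸ act_mem_κ_act (h.act_mem_κ x y) (u x) (u y)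

theorem isEpsLift_iff_isTrivialOn_add {ε' : twoK K → twoK K → TwoTorsion K} :
    r.IsEpsLift ε' ↔ IsTrivialOn ⊤ (ε + ε') := by
  have key (x y : twoK K) :
      r.eps x y = Submodule.Quotient.mk (ε' x y) ↔ IsTrivialAt (ε + ε') x y := by
    rw [h x y]
    exact smodEq_iff_add_mem (V := TwoTorsion K)
  exact ⟨fun h' x _ y _ => (key x y).1 (h' x y), fun h' x y => (key x y).2 (h' x trivial y trivial)⟩

theorem exists_isEpsLift_iff {ε' : twoK K → twoK K → TwoTorsion K} :
    (∃ r' : Reps K, r'.IsEpsLift ε') ↔ IsTrivializableOn ⊤ (ε + ε') := by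
  constructor
  · rintro ⟨r', h'⟩
    obtain ⟨u, hu, rfl⟩ := exists_translate_eq r r'
    refine ⟨u, hu, ?_⟩
    rwa [add_right_comm, ← (h.translate hu).isEpsLift_iff_isTrivialOn_add]
  · rintro ⟨u, hu, htriv⟩
    refine ⟨_, (h.translate hu).isEpsLift_iff_isTrivialOn_add.2 ?_⟩
    rwa [add_right_comm]

end IsEpsLift

end Reps

end Representatives

section Index

variable {K : Type u} [KummerStructure K] {X : Submodule (ZMod 2) (twoK K)}

theorem indSub_eq_zero_or_one (X : Submodule (ZMod 2) (twoK K)) :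
    indSub X = 0 ∨ indSub X = 1 := by
  rw [indSub]
  split_ifs <;> simp

theorem Reps.IsEpsLift.isTrivialOn_of_eps_eq_zero {r : Reps K} {ε : twoK K → twoK K → TwoTorsion K}
    (h : r.IsEpsLift ε)
    (hX : ∀ x ∈ X, ∀ y ∈ X, Module.finrank (ZMod 2) (Submodule.span (ZMod 2) {x, y}) = 2 →
      r.eps x y = 0) : IsTrivialOn X ε := fun x hx y hy => by
  have hε := h.isKummerCocycle
  rcases eq_or_ne x 0 with rfl | hx0
  · exact hε.isTrivialAt_zero_left y
  rcases eq_or_ne y 0 with rfl | hy0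
  · exact hε.isTrivialAt_zero_right x
  rcases eq_or_ne x y with rfl | hxy
  · exact hε.isTrivialAt_self x
  have key := hX x hx y hy (finrank_span_pair_eq_two hx0 hy0 hxy)
  rwa [h x y, Submodule.Quotient.mk_eq_zero] at key

theorem indSub_eq_zero_iff (hX : Module.finrank (ZMod 2) X = 3) :
    indSub X = 0 ↔ ∃ r : Reps K, r.IsEpsLift 0 := by
  classical
  rw [indSub, ite_eq_left_iff, imp_iff_not one_ne_zero, not_not]
  constructor
  · rintro ⟨r, hr⟩
    obtain ⟨ε, h⟩ := r.exists_isEpsLift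
    have htriv := (h.isTrivialOn_of_eps_eq_zero hr).isTrivializableOn
    rw [h.exists_isEpsLift_iff, add_zero]
    exact (h.isKummerCocycle.isTrivializableOn_iff_top hX).1 htriv
  · rintro ⟨r, hr⟩
    exact ⟨r, fun x _ y _ _ => hr x y⟩

theorem indSub_eq_ind (hX : Module.finrank (ZMod 2) X = 3) : indSub X = ind K := by
  have hex : ∃ Y : Submodule (ZMod 2) (twoK K), Module.finrank (ZMod 2) Y = 3 := ⟨X, hX⟩
  have hiff : indSub X = 0 ↔ indSub hex.choose = 0 := by
    rw [indSub_eq_zero_iff hX, indSub_eq_zero_iff hex.choose_spec]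
  rw [ind, dif_pos hex]
  have hX01 := indSub_eq_zero_or_one X
  have hY01 := indSub_eq_zero_or_one hex.choose
  lia

theorem exists_isEpsLift_of_rank_le_two (hrank : Module.rank (ZMod 2) (twoK K) ≤ 2)
    {ε' : twoK K → twoK K → TwoTorsion K} (h' : IsKummerCocycle ε') :
    ∃ r : Reps K, r.IsEpsLift ε' := by
  obtain ⟨r⟩ := nonempty_reps (K := K)
  obtain ⟨ε, h⟩ := r.exists_isEpsLift
  exact h.exists_isEpsLift_iff.2 ((h.isKummerCocycle.add h').isTrivializableOn_top hrank)

theorem exists_isEpsLift_zero_iff : (∃ r : Reps K, r.IsEpsLift 0) ↔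
    Module.rank (ZMod 2) (twoK K) ≤ 2 ∨ ind K = 0 := by
  obtain hrank | ⟨hrank, X, hX⟩ :=
    rank_le_two_or_exists_finrank_eq_three (k := ZMod 2) (M := twoK K)
  · exact iff_of_true (exists_isEpsLift_of_rank_le_two hrank isKummerCocycle_zero) (.inl hrank)
  · rw [or_iff_right hrank, ← indSub_eq_ind hX, indSub_eq_zero_iff hX]

theorem exists_isDoublingCocycle_isEpsLift_iff :
    (∃ S, IsDoublingCocycle S ∧ ∃ r : Reps K, r.IsEpsLift S) ↔
      Module.rank (ZMod 2) (twoK K) ≤ 2 ∨ ind K = 1 := by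
  obtain ⟨S, hS⟩ := exists_isDoublingCocycle (twoK K)
  obtain hrank | ⟨hrank, X, hX⟩ :=
    rank_le_two_or_exists_finrank_eq_three (k := ZMod 2) (M := twoK K)
  · exact iff_of_true ⟨S, hS, exists_isEpsLift_of_rank_le_two hrank hS.isKummerCocycle⟩ (.inl hrank)
  rw [or_iff_right hrank, ← indSub_eq_ind hX]
  have h01 := indSub_eq_zero_or_one X
  have hne : indSub X = 1 ↔ ¬ ∃ r : Reps K, r.IsEpsLift 0 := by
    rw [← indSub_eq_zero_iff hX]
    lia
  rw [hne]
  constructor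
  · rintro ⟨S, hS, r, h⟩ h0
    rw [h.exists_isEpsLift_iff, add_zero, ← h.isKummerCocycle.isTrivializableOn_iff_top hX] at h0
    exact hS.not_isTrivializableOn hX h0
  · intro h0
    refine ⟨S, hS, ?_⟩
    obtain ⟨r⟩ := nonempty_reps (K := K)
    obtain ⟨ε, h⟩ := r.exists_isEpsLift
    have hε := h.isKummerCocycle
    have hεS := hε.add hS.isKummerCocycle
    rw [h.exists_isEpsLift_iff, add_zero, ← hε.isTrivializableOn_iff_top hX] at h0
    rw [h.exists_isEpsLift_iff, ← hεS.isTrivializableOn_iff_top hX]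
    exact ((hε.isTrivializableOn_or hS.isKummerCocycle hX).resolve_left h0).resolve_left
      (hS.not_isTrivializableOn hX)

end Index

section Presentations

variable {K : Type u} [KummerStructure K]

/-- `π` identifies `K` with the quotient of the abelian group `G` by the involution `ι`, which is a
Kummer of `G` if `ι` is the negation and a twisted Kummer if `G` is 2-torsion. -/
structure IsPresentation {G : Type*} [AddCommGroup G] (ι : G ≃+ G) (π : G → K) : Prop where
  surjective : Function.Surjective π
  apply_eq_iff (x y) : π x = π y ↔ y = x ∨ y = ι x
  κ_apply (x y) : κ s(π x, π y) = s(π (x + y), π (x + ι y))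

section InvQuot

variable {G : Type u} [AddCommGroup G] {ι : G ≃+ G} {hι : ∀ x, ι (ι x) = x}

theorem IsPresentation.exists_equiv {π : G → K} (hπ : IsPresentation ι π) :
    ∃ f : K ≃ InvQuot ι hι, ∀ p, Sym2.map f (κ p) = InvQuot.kap ι hι (Sym2.map f p) := by
  let g : InvQuot ι hι → K := Quotient.lift π fun x y h => (hπ.apply_eq_iff x y).2 h
  have hg : Function.Bijective g := by
    refine ⟨?_, fun a => (hπ.surjective a).imp' (InvQuot.mk ι hι) fun _ h => h⟩
    rintro ⟨x⟩ ⟨y⟩ hxy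
    exact InvQuot.mk_eq_iff.2 ((hπ.apply_eq_iff x y).1 hxy)
  let f : K ≃ InvQuot ι hι := (Equiv.ofBijective g hg).symm
  have hf (x : G) : f (π x) = InvQuot.mk ι hι x :=
    (Equiv.ofBijective g hg).symm_apply_apply (InvQuot.mk ι hι x)
  refine ⟨f, fun p => ?_⟩
  induction p with | _ a b
  obtain ⟨x, rfl⟩ := hπ.surjective a
  obtain ⟨y, rfl⟩ := hπ.surjective b
  rw [hπ.κ_apply, Sym2.map_mk, Sym2.map_mk, hf, hf, hf, hf, InvQuot.kap_mk]

theorem exists_isPresentation_of_equiv {f : K ≃ InvQuot ι hι}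
    (hf : ∀ p, Sym2.map f (κ p) = InvQuot.kap ι hι (Sym2.map f p)) :
    ∃ π : G → K, IsPresentation ι π := by
  refine ⟨fun x => f.symm (InvQuot.mk ι hι x), fun a => ?_, fun x y => ?_, fun x y => ?_⟩
  · obtain ⟨x, hx⟩ := Quotient.exists_rep (f a)
    exact ⟨x, f.symm_apply_eq.2 hx⟩
  · rw [f.symm.injective.eq_iff, InvQuot.mk_eq_iff]
  · apply Sym2.map.injective f.injective
    simp only [hf, Sym2.map_mk, f.apply_symm_apply, InvQuot.kap_mk]

end InvQuot

theorem nonempty_iso_kummer_iff {G : Type u} [AddCommGroup G] :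
    Nonempty (Iso K (Kummer G)) ↔ ∃ π : G → K, IsPresentation (AddEquiv.neg G) π := by
  constructor
  · rintro ⟨f, hf⟩
    exact exists_isPresentation_of_equiv hf
  · rintro ⟨π, hπ⟩
    obtain ⟨f, hf⟩ := hπ.exists_equiv
    exact ⟨⟨f, hf⟩⟩

theorem nonempty_iso_twistedKummer_iff {G : Type u} [AddCommGroup G] {T : TwistedGroup G} :
    Nonempty (Iso K (TwistedKummer T)) ↔ ∃ π : G → K, IsPresentation T.ι π := by
  constructor
  · rintro ⟨f, hf⟩
    exact exists_isPresentation_of_equiv hf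
  · rintro ⟨π, hπ⟩
    obtain ⟨f, hf⟩ := hπ.exists_equiv
    exact ⟨⟨f, hf⟩⟩

end Presentations

section Extension

variable {V : Type*} [AddCommGroup V] [Module (ZMod 2) V] {W : Submodule (ZMod 2) V}
  {S : W → W → V}

/-- The extension of `W` by `V` with cocycle `S`. -/
@[ext]
structure Extension (hS : IsSymmCocycle S) where
  fst : W
  snd : V

namespace Extension

variable {hS : IsSymmCocycle S}

instance : Add (Extension hS) := ⟨fun p q => ⟨p.fst + q.fst, p.snd + q.snd + S p.fst q.fst⟩⟩

instance : Zero (Extension hS) := ⟨⟨0, 0⟩⟩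

instance : Neg (Extension hS) := ⟨fun p => ⟨p.fst, p.snd + S p.fst p.fst⟩⟩

theorem fst_zero : (0 : Extension hS).fst = 0 := rfl

theorem snd_zero : (0 : Extension hS).snd = 0 := rfl

theorem fst_add (p q : Extension hS) : (p + q).fst = p.fst + q.fst := rfl

theorem snd_add (p q : Extension hS) : (p + q).snd = p.snd + q.snd + S p.fst q.fst := rfl

theorem fst_neg (p : Extension hS) : (-p).fst = p.fst := rfl

theorem snd_neg (p : Extension hS) : (-p).snd = p.snd + S p.fst p.fst := rfl

instance : AddCommGroup (Extension hS) where
  add_assoc p q r := by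
    ext1
    · exact add_assoc _ _ _
    · simp only [snd_add, fst_add]
      linear_combination (norm := module) hS.assoc p.fst q.fst r.fst
  zero_add p := by
    ext1
    · exact zero_add _
    · simp only [snd_add, fst_zero, snd_zero, hS.zero_left, zero_add, add_zero]
  add_zero p := by
    ext1
    · exact add_zero _
    · simp only [snd_add, fst_zero, snd_zero, hS.zero, add_zero]
  nsmul := nsmulRec
  zsmul := zsmulRec
  neg_add_cancel p := by
    ext1
    · exact ZModModule.add_self _
    · simp only [snd_add, fst_neg, snd_neg, snd_zero]
      rw [add_right_comm, add_assoc p.snd, ZModModule.add_self, add_zero, ZModModule.add_self]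
  add_comm p q := by
    ext1
    · exact add_comm _ _
    · rw [snd_add, snd_add, hS.comm, add_comm p.snd]

variable (hS) in
/-- The automorphism `(w, v) ↦ (w, v + w)` of the extension. -/
def shift : Extension hS ≃+ Extension hS where
  toFun p := ⟨p.fst, p.snd + p.fst⟩
  invFun p := ⟨p.fst, p.snd + p.fst⟩
  left_inv p := by simp only [add_assoc, ZModModule.add_self, add_zero]
  right_inv p := by simp only [add_assoc, ZModModule.add_self, add_zero]
  map_add' p q := by
    ext1
    · rfl
    · simp only [snd_add, fst_add, Submodule.coe_add]
      abel

theorem fst_shift (p : Extension hS) : (shift hS p).fst = p.fst := rfl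

theorem snd_shift (p : Extension hS) : (shift hS p).snd = p.snd + p.fst := rfl

theorem shift_eq_neg (hS : IsDoublingCocycle S) :
    shift hS.toIsSymmCocycle = AddEquiv.neg (Extension hS.toIsSymmCocycle) := by
  ext1 p
  ext1
  · rfl
  · exact congrArg (p.snd + ·) (hS.self p.fst).symm

variable (W) in
/-- The split extension of `W` by `V` with the involution `shift`. -/
def twistedGroup :
    TwistedGroup (Extension (isSymmCocycle_zero : IsSymmCocycle (0 : W → W → V))) where
  two_torsion p := by
    ext1
    · exact ZModModule.add_self _
    · rw [snd_add, ZModModule.add_self]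
      exact zero_add _
  ι := shift isSymmCocycle_zero
  ι_ι := (shift isSymmCocycle_zero).left_inv

end Extension

end Extension

section PresentationOfReps

variable {K : Type u} [KummerStructure K] {r : Reps K} {S : twoK K → twoK K → TwoTorsion K}

theorem Reps.act_e_eq_iff {w w' : twoK K} {v v' : TwoTorsion K} :
    act (r.e w) v = act (r.e w') v' ↔ w' = w ∧ (v' = v ∨ v' = v + w.1) := by
  constructor
  · intro h
    have hw := congrArg dbl h
    rw [dbl_act, dbl_act, r.dbl_e, r.dbl_e, TwoTorsion.val_inj, Subtype.val_inj] at hw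
    subst hw
    exact ⟨rfl, (act_eq_act_iff (r.dbl_e w)).1 h⟩
  · rintro ⟨rfl, h⟩
    exact (act_eq_act_iff (r.dbl_e w')).2 h

theorem Reps.exists_act_e_eq (h4 : ∀ a : K, dbl (dbl a) = zero) (r : Reps K) (a : K) :
    ∃ w v, act (r.e w) v = a := by
  have hdbl : dbl (r.e ⟨⟨dbl a, h4 a⟩, a, rfl⟩) = dbl a := r.dbl_e _
  obtain ⟨v, hv⟩ := exists_eq_act hdbl (by rw [hdbl, h4])
  exact ⟨_, v, hv.symm⟩

theorem κ_eq_of_mem {a b c : K} {y : TwoTorsion K} (hb : dbl b = y.1) (hc : c ∈ κ s(a, b)) :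
    κ s(a, b) = s(c, act c y) := by
  obtain ⟨d, hd⟩ := hc
  have hy : y.1 ∈ κ s(c, d) := by
    rw [κ_κ hd, ← hb]
    exact Sym2.mem_mk_right _ _
  rwa [eq_act_iff.2 (mem_κ_comm.1 hy)] at hd

theorem Reps.IsEpsLift.isPresentation (h4 : ∀ a : K, dbl (dbl a) = zero) (h : r.IsEpsLift S)
    (hS : IsSymmCocycle S) :
    IsPresentation (Extension.shift hS) fun p => act (r.e p.fst) p.snd where
  surjective a := by
    obtain ⟨w, v, hwv⟩ := r.exists_act_e_eq h4 a
    exact ⟨⟨w, v⟩, hwv⟩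
  apply_eq_iff p q := by
    rw [Reps.act_e_eq_iff, and_or_left, Extension.ext_iff, Extension.ext_iff]
    rfl
  κ_apply p q := by
    have hmem := act_mem_κ_act (h.act_mem_κ p.fst q.fst) p.snd q.snd
    rw [← act_add] at hmem
    rw [κ_eq_of_mem ((dbl_act _ _).trans (r.dbl_e q.fst)) hmem, ← act_add]
    simp only [Extension.fst_add, Extension.snd_add, Extension.fst_shift, Extension.snd_shift]
    congr! 2 <;> abel

end PresentationOfReps

section RepsOfPresentation

variable {K : Type u} [KummerStructure K] {G : Type*} [AddCommGroup G]

namespace IsPresentation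

variable {ι : G ≃+ G} {π : G → K} (hπ : IsPresentation ι π)
include hπ

theorem add_mem_κ (x y : G) : π (x + y) ∈ κ s(π x, π y) := by
  rw [hπ.κ_apply]
  exact Sym2.mem_mk_left _ _

theorem apply_zero : π 0 = zero := by
  have h := zero_mem_κ.2 (Eq.refl (π 0))
  rw [hπ.κ_apply, map_zero, add_zero, Sym2.mem_iff, or_self] at h
  exact h.symm

theorem apply_add_eq_act (x : G) {y : G} {v : TwoTorsion K} (hy : π y = v.1) :
    π (x + y) = act (π x) v := by
  rw [eq_act_iff, ← hy]
  exact hπ.add_mem_κ x y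

/-- The homomorphism `G → 2K` induced by the doubling map of `K`. -/
noncomputable def dblHom (h4 : ∀ a : K, dbl (dbl a) = zero) : G →+ twoK K :=
  AddMonoidHom.mk' (fun x => ⟨⟨dbl (π x), h4 (π x)⟩, π x, rfl⟩) fun x y =>
    Subtype.ext (Subtype.ext (dbl_eq_add rfl rfl (hπ.add_mem_κ x y)))

theorem coe_dblHom (h4 : ∀ a : K, dbl (dbl a) = zero) (x : G) :
    (hπ.dblHom h4 x).1.1 = dbl (π x) := rfl

theorem dblHom_surjective (h4 : ∀ a : K, dbl (dbl a) = zero) :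
    Function.Surjective (hπ.dblHom h4) := by
  rintro ⟨v, a, ha⟩
  obtain ⟨x, rfl⟩ := hπ.surjective a
  exact ⟨x, Subtype.ext (Subtype.ext ha)⟩

/-- The homomorphism to `K[2]` induced by `π` on the preimage of `K[2]`. -/
noncomputable def kerHom (h4 : ∀ a : K, dbl (dbl a) = zero) : (hπ.dblHom h4).ker →+ TwoTorsion K :=
  AddMonoidHom.mk' (fun x => ⟨π x, congrArg (fun w : twoK K => w.1.1) x.2⟩) fun x _ =>
    Subtype.ext (hπ.apply_add_eq_act x rfl)

theorem coe_kerHom (h4 : ∀ a : K, dbl (dbl a) = zero) (x : (hπ.dblHom h4).ker) :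
    (hπ.kerHom h4 x).1 = π x := rfl

theorem exists_isEpsLift (h4 : ∀ a : K, dbl (dbl a) = zero) {σ : twoK K → G}
    (hσ : Function.RightInverse σ (hπ.dblHom h4)) (hσ0 : σ 0 = 0) :
    ∃ S, IsSymmCocycle S ∧ (∃ r : Reps K, r.IsEpsLift S) ∧
      ∀ x y, (S x y).1 = π (σ x + σ y - σ (x + y)) := by
  have hker (x y : twoK K) : σ x + σ y - σ (x + y) ∈ (hπ.dblHom h4).ker := by
    rw [AddMonoidHom.mem_ker, map_sub, map_add, hσ, hσ, hσ, sub_self]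
  let c (x y : twoK K) : (hπ.dblHom h4).ker := ⟨σ x + σ y - σ (x + y), hker x y⟩
  let r : Reps K :=
    { e := fun x => π (σ x)
      dbl_e := fun x => congrArg (fun w : twoK K => w.1.1) (hσ x)
      e_zero := by rw [hσ0, hπ.apply_zero] }
  refine ⟨fun x y => hπ.kerHom h4 (c x y), ⟨fun x => ?_, fun x y => ?_, fun x y z => ?_⟩,
    ⟨r, fun x y => (r.eps_eq_mk_iff x y _).2 ?_⟩, fun x y => rfl⟩
  · have hc : c x 0 = 0 := Subtype.ext (by simp only [c, hσ0, add_zero, sub_self]; rfl)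
    rw [hc, map_zero]
  · have hc : c x y = c y x := Subtype.ext (by simp only [c, add_comm])
    rw [hc]
  · have hc : c x y + c (x + y) z = c x (y + z) + c y z := by
      ext
      simp only [c, AddSubgroup.coe_add, add_assoc]
      abel
    rw [← map_add, hc, map_add]
  · rw [← hπ.apply_add_eq_act (σ (x + y)) (hπ.coe_kerHom h4 (c x y)).symm, add_sub_cancel]
    exact hπ.add_mem_κ (σ x) (σ y)

end IsPresentation

theorem IsPresentation.dbl_apply_of_neg {π : G → K} (hπ : IsPresentation (AddEquiv.neg G) π)
    (x : G) : dbl (π x) = π (x + x) := by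
  have h := hπ.κ_apply x x
  rw [κ_self, AddEquiv.neg_apply, add_neg_cancel, hπ.apply_zero, Sym2.eq_swap, Sym2.congr_left] at h
  exact h

theorem IsPresentation.exists_isDoublingCocycle_isEpsLift (h4 : ∀ a : K, dbl (dbl a) = zero)
    {π : G → K} (hπ : IsPresentation (AddEquiv.neg G) π) :
    ∃ S, IsDoublingCocycle S ∧ ∃ r : Reps K, r.IsEpsLift S := by
  classical
  have hinv := Function.rightInverse_surjInv (hπ.dblHom_surjective h4)
  let σ := Function.update (Function.surjInv (hπ.dblHom_surjective h4)) 0 0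
  have hσ0 : σ 0 = 0 := Function.update_self ..
  have hσ : Function.RightInverse σ (hπ.dblHom h4) := by
    intro x
    obtain rfl | hx := eq_or_ne x 0
    · rw [hσ0, map_zero]
    · simp only [σ, Function.update_of_ne hx, hinv x]
  obtain ⟨S, hS, hr, hSσ⟩ := hπ.exists_isEpsLift h4 hσ hσ0
  refine ⟨S, ⟨hS, fun x => Subtype.ext ?_⟩, hr⟩
  rw [hSσ, ZModModule.add_self x, hσ0, sub_zero, ← hπ.dbl_apply_of_neg, ← hπ.coe_dblHom h4, hσ]

theorem IsPresentation.exists_isEpsLift_zero (h4 : ∀ a : K, dbl (dbl a) = zero)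
    {T : TwistedGroup G} {π : G → K} (hπ : IsPresentation T.ι π) :
    ∃ r : Reps K, r.IsEpsLift 0 := by
  let _ : Module (ZMod 2) G :=
    AddCommGroup.zmodModule fun x => (two_nsmul x).trans (T.two_torsion x)
  obtain ⟨σ, hσ⟩ := ((hπ.dblHom h4).toZModLinearMap 2).exists_rightInverse_of_surjective
    (LinearMap.range_eq_top.2 (hπ.dblHom_surjective h4))
  obtain ⟨S, -, hr, hSσ⟩ := hπ.exists_isEpsLift h4 (LinearMap.congr_fun hσ) (map_zero σ)
  have hS : S = 0 := by
    ext x y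
    apply Subtype.ext
    rw [hSσ, map_add, sub_self, hπ.apply_zero]
    rfl
  exact hS ▸ hr

theorem exists_iso_kummer_iff (h4 : ∀ a : K, dbl (dbl a) = zero) :
    (∃ (G : Type u) (_ : AddCommGroup G), Nonempty (Iso K (Kummer G))) ↔
      ∃ S, IsDoublingCocycle S ∧ ∃ r : Reps K, r.IsEpsLift S := by
  simp only [nonempty_iso_kummer_iff]
  constructor
  · rintro ⟨G, _, π, hπ⟩
    exact hπ.exists_isDoublingCocycle_isEpsLift h4
  · rintro ⟨S, hS, r, hr⟩
    exact ⟨Extension hS.toIsSymmCocycle, inferInstance, _,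
      Extension.shift_eq_neg hS ▸ hr.isPresentation h4 hS.toIsSymmCocycle⟩

theorem exists_iso_twistedKummer_iff (h4 : ∀ a : K, dbl (dbl a) = zero) :
    (∃ (G : Type u) (_ : AddCommGroup G) (T : TwistedGroup G),
      Nonempty (Iso K (TwistedKummer T))) ↔ ∃ r : Reps K, r.IsEpsLift 0 := by
  simp only [nonempty_iso_twistedKummer_iff]
  constructor
  · rintro ⟨G, _, T, π, hπ⟩
    exact hπ.exists_isEpsLift_zero h4
  · rintro ⟨r, hr⟩
    exact ⟨_, inferInstance, Extension.twistedGroup (twoK K), _,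
      hr.isPresentation h4 isSymmCocycle_zero⟩

end RepsOfPresentation

end KummerStructure

open KummerStructure in
theorem mainTheorem3 (K : Type u) [KummerStructure K]
    (h4 : ∀ a : K, dbl (dbl a) = zero)
    (h2 : ∃ a : K, dbl a ≠ zero) :
    (∀ X : Submodule (ZMod 2) (twoK K), Module.finrank (ZMod 2) X = 3 → indSub X = ind K) ∧
    ((∃ (G : Type u) (_ : AddCommGroup G), Nonempty (Iso K (Kummer G))) ↔
      (Module.rank (ZMod 2) (twoK K) ≤ 2 ∨ ind K = 1)) ∧
    ((∃ (G : Type u) (_ : AddCommGroup G) (T : TwistedGroup G),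
        Nonempty (Iso K (TwistedKummer T))) ↔
      (Module.rank (ZMod 2) (twoK K) ≤ 2 ∨ ind K = 0)) := by
  exact ⟨fun _ hX => indSub_eq_ind hX,
    (exists_iso_kummer_iff h4).trans exists_isDoublingCocycle_isEpsLift_iff,
    (exists_iso_twistedKummer_iff h4).trans exists_isEpsLift_zero_iff⟩
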